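/- Let $K\subset\mathbb R^2$ be a convex body (a compact convex set with nonempty interior) whose boundary is a curve of class $C^2$ (in particular, $K$ may be any convex body with $C^\infty$ boundary), and suppose that $K$ is not a disk. Let $r_{\min}(0)$ be the minimal curvature radius of $\partial K$, that is, the reciprocal of the maximum of the curvature of $\partial K$. Let $h_K(u)=\max_{x\in K}\langle x,u\rangle$ be the support function of $K$ and, for $t\ge 0$, let $$K(t)=\bigcap_{|u|=1}\{x\in\mathbb R^2:\langle x,u\rangle\le h_K(u)-t\}.$$ For a plane convex body $M$ let $I(M)=V(M)/A(M)^2$, where $V(M)$ is the area and $A(M)$ the perimeter of $M$. Then $r_{\min}(0)>0$, $K(t)$ is a convex body for every $t\in[0,r_{\min}(0)]$, and $t\mapsto I(K(t))$ is a strictly concave function on $[0,r_{\min}(0)]$. -/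

import Mathlib

open Set MeasureTheory
open scoped InnerProductSpace

noncomputable section

namespace PlaneConvex

/-- The Euclidean plane. -/
abbrev Plane : Type := EuclideanSpace ℝ (Fin 2)

/-- The support function `h_K(u) = sup {⟪x, u⟫ : x ∈ K}`. -/
def supportFun (K : Set Plane) (u : Plane) : ℝ :=
  sSup ((fun x : Plane => ⟪x, u⟫_ℝ) '' K)

/-- The inner parallel body `K(t)`: the intersection, over all unit vectors `u`, of the closed
half-planes `{x : ⟪x, u⟫ ≤ h_K(u) - t}`. -/
def innerParallel (K : Set Plane) (t : ℝ) : Set Plane :=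
  {x : Plane | ∀ u : Plane, ‖u‖ = 1 → ⟪x, u⟫_ℝ ≤ supportFun K u - t}

/-- The area `V(M)`, i.e. Lebesgue measure. -/
def area (M : Set Plane) : ℝ := (volume M).toReal

/-- The perimeter `A(M)`, i.e. the one-dimensional Hausdorff measure (length) of the boundary. -/
def perimeter (M : Set Plane) : ℝ := (Measure.hausdorffMeasure 1 (frontier M) : ENNReal).toReal

/-- The planar isoperimetric quotient `I(M) = V(M) / A(M) ^ 2`. -/
def isoQuotient (M : Set Plane) : ℝ := area M / perimeter M ^ 2

/-- `γ` is a `C²` arc-length parametrization, of period `ℓ`, of the boundary of `K` as a simple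
closed curve. A plane convex body has a `C²` boundary exactly if it admits such a `γ`. -/
structure IsArcLengthBoundary (K : Set Plane) (γ : ℝ → Plane) (ℓ : ℝ) : Prop where
  contDiff : ContDiff ℝ 2 γ
  unit_speed : ∀ s, ‖deriv γ s‖ = 1
  length_pos : 0 < ℓ
  periodic : Function.Periodic γ ℓ
  injOn : InjOn γ (Ico 0 ℓ)
  range_eq : range γ = frontier K

/-- The curvature of a curve parametrized by arc length. -/
def curvature (γ : ℝ → Plane) (s : ℝ) : ℝ := ‖deriv (deriv γ) s‖

/-- The minimal curvature radius: the reciprocal of the maximal curvature. -/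
def minCurvatureRadius (γ : ℝ → Plane) : ℝ := (⨆ s, curvature γ s)⁻¹

end PlaneConvex

end

/-!
The area `V` and the perimeter `A` of the inner parallel bodies of a plane convex body `K` with `C²`
boundary are given, up to the least radius of curvature, by Steiner's formulas
`V (t) = V - t A + π t²` and `A (t) = A - 2 π t` (`IsOval.toReal_volume_region_offset`,
`IsOval.toReal_hausdorffMeasure_frontier_offset`). Hence
`V (t) / A (t)² = (1 - D / A (t)²) / (4 π)` with the isoperimetric deficit `D = A² - 4 π V`, and
`x ↦ -x⁻²` is strictly concave; `D > 0` because `K` is not a disk (`IsOval.four_pi_mul_volume_lt`).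

Identify the plane with `ℂ`. The boundary, positively oriented and parametrized by arc length, is a
curve `c` with tangent angle `θ` and curvature `k = θ' ≥ 0`, and `θ` increases by exactly `2 π` over a
period: the tangent angle follows the polar angle about an interior point, and a ray from that point
meets the boundary only once (`IsUnitSpeedBoundary.exists_isOval`). The body `K (t)` is the
intersection of the half-planes to the left of the tangents of the offset curve `c + t i e^{iθ}`,
which has the same tangent angle and speed `1 - t k ≥ 0`. So all bodies `K (t)` are covered by the
notion `IsOval` of a closed curve with monotone tangent angle turning once and nonnegative, possibly
vanishing, speed. For such a curve the area is the integral of the Jacobian of the cone over the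
curve with apex at an interior point (`IsOval.volume_region`), and the Hausdorff measure of the
frontier is the integral of the speed (`IsOval.hausdorffMeasure_frontier`).

The isoperimetric inequality with its equality case comes from Parseval's identity, following
Hurwitz (`hasSum_isoperimetric_deficit`). That `K (t)` keeps an interior up to and including the least
radius of curvature uses the continuity of the curvature
(`IsOval.interior_region_offset_nonempty`).
-/

namespace ConvexCurve

open Complex (I)
open scoped ComplexConjugate

/-! ### Polar angle along a plane curve -/

/-- A nowhere vanishing `C¹` curve has a differentiable polar angle. -/
theorem exists_polar_angle {w w' : ℝ → ℂ} (hw : ∀ s, HasDerivAt w (w' s) s)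
    (hw' : Continuous w') (hne : ∀ s, w s ≠ 0) :
    ∃ φ : ℝ → ℝ, (∀ s, HasDerivAt φ (w' s / w s).im s) ∧
      ∀ s, w s = ‖w s‖ * Complex.exp (φ s * I) := by
  have hwc : Continuous w := continuous_iff_continuousAt.2 fun s => (hw s).continuousAt
  have hc : Continuous fun s => w' s / w s := hw'.div hwc hne
  set L : ℝ → ℂ := fun s => ∫ x in (0 : ℝ)..s, w' x / w x with hL
  have hLd : ∀ s, HasDerivAt L (w' s / w s) s := fun s =>
    (hc.integral_hasStrictDerivAt 0 s).hasDerivAt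
  have hexp : ∀ s, w s = w 0 * Complex.exp (L s) := by
    have hd : ∀ s, HasDerivAt (fun s => w s * Complex.exp (-L s)) 0 s := by
      intro s
      have h := (hw s).mul ((hLd s).neg.cexp)
      have h0 : w' s * Complex.exp (-L s) + w s * (Complex.exp (-L s) * -(w' s / w s)) = 0 := by
        have := hne s
        field_simp
        ring
      exact h0 ▸ h
    intro s
    have h := is_const_of_deriv_eq_zero (fun s => (hd s).differentiableAt)
      (fun s => (hd s).deriv) s 0
    have h0 : L 0 = 0 := by simp [hL]
    simp only [h0, neg_zero, Complex.exp_zero, mul_one] at h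
    rw [← h, mul_assoc, ← Complex.exp_add]
    simp
  refine ⟨fun s => (w 0).arg + (L s).im, fun s => ?_, fun s => ?_⟩
  · exact (Complex.imCLM.hasFDerivAt.comp_hasDerivAt s (hLd s)).const_add _
  · have h1 : ‖w s‖ = ‖w 0‖ * Real.exp (L s).re := by
      rw [hexp s, norm_mul, Complex.norm_exp]
    rw [h1, hexp s]
    conv_lhs => rw [← Complex.norm_mul_exp_arg_mul_I (w 0), mul_assoc, ← Complex.exp_add]
    push_cast
    rw [mul_assoc, ← Complex.exp_add]
    congr 2
    conv_lhs => rw [← Complex.re_add_im (L s)]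
    ring

/-- A continuous real function along which the sine stays positive oscillates by less than `π`. -/
theorem abs_sub_lt_pi_of_sin_pos {g : ℝ → ℝ} (hg : Continuous g)
    (hs : ∀ s, 0 < Real.sin (g s)) (a b : ℝ) : |g a - g b| < Real.pi := by
  have key : ∀ a b, g a - g b < Real.pi := by
    intro a b
    by_contra! h
    obtain ⟨x, hx⟩ := mem_range_of_exists_le_of_exists_ge hg
      ⟨b, show g b ≤ g b + Real.pi by linarith [Real.pi_pos]⟩
      ⟨a, show g b + Real.pi ≤ g a by linarith⟩
    have := hs x
    rw [hx, Real.sin_add_pi] at this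
    linarith [hs b]
  rw [abs_lt]
  exact ⟨by linarith [key b a], key a b⟩

theorem exists_int_of_exp_eq {a b : ℝ} (h : Complex.exp (a * I) = Complex.exp (b * I)) :
    ∃ m : ℤ, a = b + m * (2 * Real.pi) := by
  obtain ⟨m, hm⟩ := Complex.exp_eq_exp_iff_exists_int.1 h
  refine ⟨m, ?_⟩
  have := congrArg Complex.im hm
  simpa using this

/-- A nonnegative derivative on `[a, b]` which is positive at some point of `[a, b]` forces a
strict increase from `a` to `b`. -/
theorem lt_of_deriv_nonneg_of_pos {f f' : ℝ → ℝ} {a b x : ℝ} (hab : a < b)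
    (hf : ∀ s ∈ Icc a b, HasDerivAt f (f' s) s) (h0 : ∀ s ∈ Icc a b, 0 ≤ f' s)
    (hx : x ∈ Icc a b) (hpos : 0 < f' x) : f a < f b := by
  have hmono : MonotoneOn f (Icc a b) := by
    apply monotoneOn_of_deriv_nonneg (convex_Icc a b)
    · exact fun s hs => (hf s hs).continuousAt.continuousWithinAt
    · exact fun s hs => (hf s (interior_subset hs)).differentiableAt.differentiableWithinAt
    · intro s hs
      rw [(hf s (interior_subset hs)).deriv]
      exact h0 s (interior_subset hs)
  by_contra! hle
  have hconst : ∀ y ∈ Icc a b, f y = f a := fun y hy => le_antisymm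
    ((hmono hy (right_mem_Icc.2 hab.le) hy.2).trans hle)
    (hmono (left_mem_Icc.2 hab.le) hy hy.1)
  have h1 : HasDerivWithinAt f (f' x) (Icc a b) x := (hf x hx).hasDerivWithinAt
  have h2 : HasDerivWithinAt f 0 (Icc a b) x :=
    (hasDerivWithinAt_const x (Icc a b) (f a)).congr hconst (hconst x hx)
  have := (uniqueDiffOn_Icc hab x hx).eq_deriv _ h1 h2
  linarith

/-! ### Frontier points on a ray -/

/-- A ray issuing from an interior point of a convex set meets the frontier at most once. -/
theorem eq_of_mem_frontier_of_ray {M : Set ℂ} (hM : Convex ℝ M) {p x y : ℂ}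
    (hp : p ∈ interior M) (hx : x ∈ frontier M) (hy : y ∈ frontier M) {r : ℝ} (hr : 0 < r)
    (h : y - p = r * (x - p)) : x = y := by
  have key : ∀ {x y : ℂ}, x ∈ closure M → y ∈ frontier M → ∀ {r : ℝ}, 0 < r → r < 1 →
      y - p = r * (x - p) → False := by
    intro x y hx hy r hr hr1 h
    refine hy.2 (hM.openSegment_interior_closure_subset_interior hp hx ?_)
    refine ⟨1 - r, r, by linarith, hr, by ring, ?_⟩
    simp only [Complex.real_smul]
    push_cast
    linear_combination -h
  rcases lt_trichotomy r 1 with h1 | h1 | h1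
  · exact (key hx.1 hy hr h1 h).elim
  · subst h1
    simp only [Complex.ofReal_one, one_mul] at h
    exact (sub_left_injective h).symm
  · refine (key hy.1 hx (inv_pos.2 hr) (inv_lt_one_of_one_lt₀ h1) ?_).elim
    rw [h]
    push_cast
    rw [inv_mul_cancel_left₀ (by exact_mod_cast hr.ne')]

/-! ### Closed convex curves given by a tangent angle and a speed -/

/-- A closed convex curve `c` of period `ℓ`, with tangent angle `θ` and speed `q`: the angle is
nondecreasing and turns exactly once per period. The speed may vanish and the angle may be constant
along arcs, so that corners and straight pieces are allowed. -/
structure IsOval (c : ℝ → ℂ) (θ q : ℝ → ℝ) (ℓ : ℝ) : Prop where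
  length_pos : 0 < ℓ
  hasDerivAt : ∀ s, HasDerivAt c (q s * Complex.exp (θ s * I)) s
  continuous_speed : Continuous q
  speed_nonneg : ∀ s, 0 ≤ q s
  continuous_angle : Continuous θ
  angle_mono : Monotone θ
  angle_add : ∀ s, θ (s + ℓ) = θ s + 2 * Real.pi
  periodic : Function.Periodic c ℓ

/-- The signed distance from the point `x` to the tangent line with direction angle `θ s` at `c s`,
positive when `x` lies to the left of that line. -/
noncomputable def slack (c : ℝ → ℂ) (θ : ℝ → ℝ) (x : ℂ) (s : ℝ) : ℝ :=
  (conj (c s - x) * Complex.exp (θ s * I)).im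

/-- The intersection of the closed half-planes to the left of the tangent lines. -/
def region (c : ℝ → ℂ) (θ : ℝ → ℝ) : Set ℂ := {x | ∀ s, 0 ≤ slack c θ x s}

variable {c : ℝ → ℂ} {θ q : ℝ → ℝ} {ℓ : ℝ}

theorem slack_eq (x : ℂ) (s : ℝ) :
    slack c θ x s = (c s - x).re * Real.sin (θ s) - (c s - x).im * Real.cos (θ s) := by
  simp only [slack, Complex.mul_im, Complex.conj_re, Complex.conj_im, Complex.exp_ofReal_mul_I_re,
    Complex.exp_ofReal_mul_I_im]
  ring

theorem slack_combo (x y : ℂ) {a b : ℝ} (hab : a + b = 1) (s : ℝ) :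
    slack c θ (a • x + b • y) s = a * slack c θ x s + b * slack c θ y s := by
  simp only [slack_eq, Complex.sub_re, Complex.sub_im, Complex.add_re, Complex.add_im,
    Complex.smul_re, Complex.smul_im, smul_eq_mul]
  linear_combination -((c s).re * Real.sin (θ s) - (c s).im * Real.cos (θ s)) * hab

@[simp] theorem slack_self (s : ℝ) : slack c θ (c s) s = 0 := by simp [slack]

/-- Moving `x` by `r` along the outer normal `-i e^{iθ}` lowers the slack by `r`. -/
theorem slack_sub_normal (x : ℂ) (s r : ℝ) :
    slack c θ (x - r * (I * Complex.exp (θ s * I))) s = slack c θ x s - r := by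
  simp only [slack_eq, Complex.sub_re, Complex.sub_im, Complex.mul_re, Complex.mul_im,
    Complex.exp_ofReal_mul_I_re, Complex.exp_ofReal_mul_I_im, Complex.I_re, Complex.I_im,
    Complex.ofReal_re, Complex.ofReal_im]
  linear_combination (-r) * Real.sin_sq_add_cos_sq (θ s)

theorem convex_region : Convex ℝ (region c θ) := by
  intro x hx y hy a b ha hb hab s
  rw [slack_combo x y hab]
  exact add_nonneg (mul_nonneg ha (hx s)) (mul_nonneg hb (hy s))

theorem continuous_slack_left (s : ℝ) : Continuous fun x => slack c θ x s := by
  unfold slack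
  fun_prop

theorem isClosed_region : IsClosed (region c θ) := by
  have : region c θ = ⋂ s, {x | 0 ≤ slack c θ x s} := by
    ext x; simp [region]
  rw [this]
  exact isClosed_iInter fun s => isClosed_le continuous_const (continuous_slack_left s)

theorem slack_pos_of_mem_interior {p : ℂ} {M : Set ℂ} (hM : M ⊆ region c θ)
    (hp : p ∈ interior M) (s : ℝ) : 0 < slack c θ p s := by
  obtain ⟨ε, hε, hball⟩ := Metric.isOpen_iff.1 isOpen_interior p hp
  have hmem : p - (ε / 2 : ℝ) * (I * Complex.exp (θ s * I)) ∈ M := by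
    apply interior_subset
    apply hball
    rw [Metric.mem_ball, dist_eq_norm, sub_sub_cancel_left, norm_neg, norm_mul, norm_mul,
      Complex.norm_exp_ofReal_mul_I, Complex.norm_I, Complex.norm_real, Real.norm_eq_abs,
      abs_of_pos (half_pos hε)]
    linarith
  have := hM hmem s
  rw [slack_sub_normal] at this
  linarith

theorem slack_ne_zero_imp_ne {p : ℂ} {s : ℝ} (h : slack c θ p s ≠ 0) : c s - p ≠ 0 := by
  intro h0
  simp [slack, h0] at h

/-- In polar coordinates about `p`, the slack is the radius times the sine of the angle between
the radius and the tangent. -/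
theorem slack_eq_norm_mul_sin {p : ℂ} {φ : ℝ → ℝ}
    (hφ : ∀ s, c s - p = ‖c s - p‖ * Complex.exp (φ s * I)) (s : ℝ) :
    slack c θ p s = ‖c s - p‖ * Real.sin (θ s - φ s) := by
  have h1 : (c s - p).re = ‖c s - p‖ * Real.cos (φ s) := by
    conv_lhs => rw [hφ s]
    simp [Complex.exp_ofReal_mul_I_re]
  have h2 : (c s - p).im = ‖c s - p‖ * Real.sin (φ s) := by
    conv_lhs => rw [hφ s]
    simp [Complex.exp_ofReal_mul_I_im]
  rw [slack_eq, h1, h2, Real.sin_sub]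
  ring

theorem polar_speed_eq {p : ℂ} (s : ℝ) :
    (q s * Complex.exp (θ s * I) / (c s - p)).im
      = q s * slack c θ p s / ‖c s - p‖ ^ 2 := by
  rw [Complex.div_im, slack_eq, ← Complex.normSq_eq_norm_sq]
  simp only [Complex.mul_re, Complex.mul_im,
    Complex.exp_ofReal_mul_I_re, Complex.exp_ofReal_mul_I_im, Complex.ofReal_re, Complex.ofReal_im]
  ring

/-- The polar angle of a closed convex curve about a point `p` strictly inside all the tangent
half-planes turns exactly once per period. -/
theorem IsOval.exists_polar_angle (h : IsOval c θ q ℓ) {p : ℂ} (hp : ∀ s, 0 < slack c θ p s) :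
    ∃ φ : ℝ → ℝ, (∀ s, HasDerivAt φ (q s * slack c θ p s / ‖c s - p‖ ^ 2) s) ∧
      (∀ s, c s - p = ‖c s - p‖ * Complex.exp (φ s * I)) ∧
      ∀ s, φ (s + ℓ) = φ s + 2 * Real.pi := by
  have hne : ∀ s, c s - p ≠ 0 := fun s => slack_ne_zero_imp_ne (hp s).ne'
  have hq := h.continuous_speed
  have hθ := h.continuous_angle
  obtain ⟨φ, hφd, hφ⟩ := ConvexCurve.exists_polar_angle (w := fun s => c s - p)
    (fun s => (h.hasDerivAt s).sub_const p) (by fun_prop) hne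
  have hφc : Continuous φ := continuous_iff_continuousAt.2 fun s => (hφd s).continuousAt
  refine ⟨φ, fun s => ?_, hφ, fun s => ?_⟩
  · rw [← polar_speed_eq]
    exact hφd s
  · have hsin : ∀ s, 0 < Real.sin (θ s - φ s) := by
      intro s
      have := hp s
      rw [slack_eq_norm_mul_sin hφ] at this
      exact pos_of_mul_pos_right this (norm_nonneg _)
    have hexp : Complex.exp (φ (s + ℓ) * I) = Complex.exp (φ s * I) := by
      have h1 := hφ (s + ℓ)
      simp only [h.periodic s] at h1
      rw [hφ s] at h1
      simp only [norm_mul, Complex.norm_real, norm_norm, Complex.norm_exp_ofReal_mul_I,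
        mul_one] at h1
      exact (mul_left_cancel₀ (by exact_mod_cast norm_ne_zero_iff.2 (hne s)) h1).symm
    obtain ⟨m, hm⟩ := exists_int_of_exp_eq hexp
    have hlt := abs_sub_lt_pi_of_sin_pos (hθ.sub hφc) hsin (s + ℓ) s
    rw [Pi.sub_apply, Pi.sub_apply, h.angle_add, hm] at hlt
    have hpi := Real.pi_pos
    rw [abs_lt] at hlt
    have h1 : (m : ℝ) < 2 := by nlinarith
    have h2 : (0 : ℝ) < m := by nlinarith
    have : m = 1 := by
      have : m < 2 := by exact_mod_cast h1
      have : 0 < m := by exact_mod_cast h2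
      omega
    rw [hm, this]
    simp

/-- A curve whose angle increases by `2π` over a period points in every direction. -/
theorem exists_mem_Ico_exp_eq {φ : ℝ → ℝ} (hφ : Continuous φ) (hℓ : 0 < ℓ)
    (hadd : ∀ s, φ (s + ℓ) = φ s + 2 * Real.pi) (u : ℂ) :
    ∃ s ∈ Ico 0 ℓ, u = ‖u‖ * Complex.exp (φ s * I) := by
  have hℓ' : φ ℓ = φ 0 + 2 * Real.pi := by simpa using hadd 0
  obtain ⟨a, ⟨ha1, ha2⟩, ha⟩ : ∃ a ∈ Ico (φ 0) (φ 0 + 2 * Real.pi),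
      u = ‖u‖ * Complex.exp (a * I) := by
    obtain ⟨m, hm, -⟩ := existsUnique_add_zsmul_mem_Ico Real.two_pi_pos u.arg (φ 0)
    refine ⟨_, hm, ?_⟩
    conv_lhs => rw [← Complex.norm_mul_exp_arg_mul_I u]
    congr 1
    rw [Complex.exp_eq_exp_iff_exists_int]
    refine ⟨-m, ?_⟩
    push_cast [zsmul_eq_mul]
    ring
  obtain ⟨s, hs, hsa⟩ := intermediate_value_Ico hℓ.le hφ.continuousOn (by rw [hℓ']; exact ⟨ha1, ha2⟩)
  exact ⟨s, hs, by rw [hsa]; exact ha⟩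

theorem hasDerivAt_slack_comp {v : ℂ} {y : ℝ} (h : HasDerivAt c v y) (s₀ : ℝ) :
    HasDerivAt (fun y => slack c θ (c y) s₀)
      (v.im * Real.cos (θ s₀) - v.re * Real.sin (θ s₀)) y := by
  have h1 := Complex.reCLM.hasFDerivAt.comp_hasDerivAt y h
  have h2 := Complex.imCLM.hasFDerivAt.comp_hasDerivAt y h
  have h0 : (fun y => slack c θ (c y) s₀) = fun y =>
      ((c s₀).re - (c y).re) * Real.sin (θ s₀) - ((c s₀).im - (c y).im) * Real.cos (θ s₀) := by
    ext y
    rw [slack_eq, Complex.sub_re, Complex.sub_im]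
  rw [h0]
  refine (((h1.const_sub (c s₀).re).mul_const (Real.sin (θ s₀))).sub
    ((h2.const_sub (c s₀).im).mul_const (Real.cos (θ s₀)))).congr_deriv ?_
  simp only [Complex.reCLM_apply, Complex.imCLM_apply]
  ring

/-- A closed convex curve lies on the left of each of its tangent lines: along one turn the slack
first increases, while the tangent angle has advanced by less than `π`, and then decreases. -/
theorem IsOval.mem_region (h : IsOval c θ q ℓ) (s : ℝ) : c s ∈ region c θ := by
  intro s₀
  -- by periodicity the point may be taken on the turn starting at `s₀`
  obtain ⟨x, hx, hcx⟩ := h.periodic.exists_mem_Ico h.length_pos s s₀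
  rw [hcx]
  have hℓ := h.length_pos
  have hd : ∀ y, HasDerivAt (fun y => slack c θ (c y) s₀) (q y * Real.sin (θ y - θ s₀)) y := by
    intro y
    refine (hasDerivAt_slack_comp (h.hasDerivAt y) s₀).congr_deriv ?_
    simp only [Complex.mul_re, Complex.mul_im, Complex.exp_ofReal_mul_I_re,
      Complex.exp_ofReal_mul_I_im, Complex.ofReal_re, Complex.ofReal_im, Real.sin_sub]
    ring
  have hθℓ := h.angle_add s₀
  obtain ⟨m, hm, hθm⟩ := intermediate_value_Icc (by linarith : s₀ ≤ s₀ + ℓ)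
    h.continuous_angle.continuousOn
    (show θ s₀ + Real.pi ∈ Icc (θ s₀) (θ (s₀ + ℓ)) by
      constructor <;> linarith [Real.pi_pos])
  rcases le_total x m with hxm | hmx
  · have hmono : MonotoneOn (fun y => slack c θ (c y) s₀) (Icc s₀ m) := by
      apply monotoneOn_of_deriv_nonneg (convex_Icc _ _)
      · exact fun y _ => (hd y).continuousAt.continuousWithinAt
      · exact fun y _ => (hd y).differentiableAt.differentiableWithinAt
      · intro y hy
        have hy := interior_subset hy
        rw [(hd y).deriv]
        exact mul_nonneg (h.speed_nonneg y) (Real.sin_nonneg_of_nonneg_of_le_pi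
          (sub_nonneg.2 (h.angle_mono hy.1)) (by linarith [h.angle_mono hy.2]))
    have := hmono (left_mem_Icc.2 hm.1) ⟨hx.1, hxm⟩ hx.1
    simpa using this
  · have hanti : AntitoneOn (fun y => slack c θ (c y) s₀) (Icc m (s₀ + ℓ)) := by
      apply antitoneOn_of_deriv_nonpos (convex_Icc _ _)
      · exact fun y _ => (hd y).continuousAt.continuousWithinAt
      · exact fun y _ => (hd y).differentiableAt.differentiableWithinAt
      · intro y hy
        have hy := interior_subset hy
        rw [(hd y).deriv]
        refine mul_nonpos_of_nonneg_of_nonpos (h.speed_nonneg y) ?_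
        rw [← Real.sin_sub_two_pi]
        exact Real.sin_nonpos_of_nonpos_of_neg_pi_le
          (by linarith [h.angle_mono hy.2]) (by linarith [h.angle_mono hy.1])
    have := hanti ⟨hmx, hx.2.le⟩ (right_mem_Icc.2 hm.2) hx.2.le
    simpa [h.periodic s₀] using this

/-- Every point other than `p` lies on a ray from `p` through a point of the curve. -/
theorem IsOval.exists_ray (h : IsOval c θ q ℓ) {p : ℂ} (hp : ∀ s, 0 < slack c θ p s) (x : ℂ) :
    ∃ s ∈ Ico 0 ℓ, ∃ r : ℝ, 0 ≤ r ∧ x - p = r * (c s - p) := by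
  obtain ⟨φ, hφd, hφ, hadd⟩ := h.exists_polar_angle hp
  have hφc : Continuous φ := continuous_iff_continuousAt.2 fun s => (hφd s).continuousAt
  obtain ⟨s, hs, hxs⟩ := exists_mem_Ico_exp_eq hφc h.length_pos hadd (x - p)
  have hne : c s - p ≠ 0 := slack_ne_zero_imp_ne (hp s).ne'
  refine ⟨s, hs, ‖x - p‖ / ‖c s - p‖, by positivity, ?_⟩
  conv_lhs => rw [hxs]
  conv_rhs => rw [hφ s]
  have : (‖c s - p‖ : ℂ) ≠ 0 := by exact_mod_cast norm_ne_zero_iff.2 hne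
  simp only [norm_mul, Complex.norm_real, norm_norm, Complex.norm_exp_ofReal_mul_I, mul_one]
  push_cast
  field_simp

theorem IsOval.mem_frontier (h : IsOval c θ q ℓ) (s : ℝ) : c s ∈ frontier (region c θ) := by
  rw [isClosed_region.frontier_eq]
  refine ⟨h.mem_region s, fun hi => ?_⟩
  simpa using slack_pos_of_mem_interior subset_rfl hi s

theorem IsOval.frontier_region (h : IsOval c θ q ℓ) (hint : (interior (region c θ)).Nonempty) :
    frontier (region c θ) = c '' Ico 0 ℓ := by
  obtain ⟨p, hp⟩ := hint
  apply Subset.antisymm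
  · intro x hx
    obtain ⟨s, hs, r, hr, hxs⟩ := h.exists_ray (slack_pos_of_mem_interior subset_rfl hp) x
    refine ⟨s, hs, eq_of_mem_frontier_of_ray convex_region hp (h.mem_frontier s) hx
      (lt_of_le_of_ne hr ?_) hxs⟩
    rintro rfl
    simp only [Complex.ofReal_zero, zero_mul, sub_eq_zero] at hxs
    exact hx.2 (hxs ▸ hp)
  · rintro _ ⟨s, -, rfl⟩
    exact h.mem_frontier s

/-- The region is the cone over the curve with any interior point as apex. -/
theorem IsOval.region_eq_cone (h : IsOval c θ q ℓ) {p : ℂ} (hp : p ∈ interior (region c θ)) :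
    region c θ = {x | ∃ s ∈ Ico 0 ℓ, ∃ r ∈ Icc (0 : ℝ) 1, x = p + r * (c s - p)} := by
  apply Subset.antisymm
  · intro x hx
    obtain ⟨s, hs, r, hr, hxs⟩ := h.exists_ray (slack_pos_of_mem_interior subset_rfl hp) x
    refine ⟨s, hs, r, ⟨hr, ?_⟩, by rw [← hxs]; ring⟩
    by_contra! hr1
    refine (h.mem_frontier s).2 (convex_region.openSegment_interior_closure_subset_interior hp
      (subset_closure hx) ⟨1 - r⁻¹, r⁻¹, sub_pos.2 (inv_lt_one_of_one_lt₀ hr1), by positivity,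
        by ring, ?_⟩)
    have hr0 : (r : ℂ) ≠ 0 := by exact_mod_cast (by positivity : r ≠ 0)
    have : x = p + r * (c s - p) := by rw [← hxs]; ring
    simp only [Complex.real_smul, this]
    push_cast
    field_simp
    ring
  · rintro _ ⟨s, -, r, hr, rfl⟩
    have := convex_region (interior_subset hp) (h.mem_region s) (sub_nonneg.2 hr.2) hr.1 (by ring)
    convert this using 1
    simp only [Complex.real_smul]
    push_cast
    ring

/-- On the part of a period where the curve moves, it meets each ray from an interior point at most
once. -/
theorem IsOval.eq_of_ray (h : IsOval c θ q ℓ) {p : ℂ} (hp : ∀ s, 0 < slack c θ p s) {s s' : ℝ}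
    (hs : s ∈ Ico 0 ℓ) (hs' : s' ∈ Ico 0 ℓ) (hq : 0 < q s) (hq' : 0 < q s') {r : ℝ} (hr : 0 < r)
    (hray : c s' - p = r * (c s - p)) : s = s' := by
  obtain ⟨φ, hφd, hφ, hadd⟩ := h.exists_polar_angle hp
  have hne : ∀ s, c s - p ≠ 0 := fun s => slack_ne_zero_imp_ne (hp s).ne'
  have hnn : ∀ s, 0 ≤ q s * slack c θ p s / ‖c s - p‖ ^ 2 := fun s =>
    div_nonneg (mul_nonneg (h.speed_nonneg s) (hp s).le) (by positivity)
  have hpos : ∀ s, 0 < q s → 0 < q s * slack c θ p s / ‖c s - p‖ ^ 2 := fun s hs =>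
    div_pos (mul_pos hs (hp s)) (by have := norm_pos_iff.2 (hne s); positivity)
  have hexp : Complex.exp (φ s' * I) = Complex.exp (φ s * I) := by
    have hn := congrArg norm hray
    rw [norm_mul, Complex.norm_real, Real.norm_eq_abs, abs_of_pos hr] at hn
    rw [hφ s, hφ s', hn, ← mul_assoc] at hray
    push_cast at hray
    refine mul_left_cancel₀ (mul_ne_zero ?_ ?_) hray
    · exact_mod_cast hr.ne'
    · exact_mod_cast norm_ne_zero_iff.2 (hne s)
  clear hray hr
  wlog hlt : s < s' generalizing s s'
  · rcases (not_lt.1 hlt).eq_or_lt with heq | hlt'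
    · exact heq.symm
    · exact (this hs' hs hq' hq hexp.symm hlt').symm
  exfalso
  have h1 : φ s < φ s' := lt_of_deriv_nonneg_of_pos hlt (fun y _ => hφd y) (fun y _ => hnn y)
    (left_mem_Icc.2 hlt.le) (hpos s hq)
  have h2 : φ s' < φ (s + ℓ) := lt_of_deriv_nonneg_of_pos (by linarith [hs.1, hs'.2])
    (fun y _ => hφd y) (fun y _ => hnn y)
    (left_mem_Icc.2 (by linarith [hs.1, hs'.2])) (hpos s' hq')
  rw [hadd] at h2
  obtain ⟨m, hm⟩ := exists_int_of_exp_eq hexp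
  have hpi := Real.pi_pos
  have h3 : (m : ℝ) < 1 := by nlinarith
  have h4 : (0 : ℝ) < m := by nlinarith
  have h5 : m < 1 := by exact_mod_cast h3
  have h6 : 0 < m := by exact_mod_cast h4
  omega

theorem IsOval.injOn (h : IsOval c θ q ℓ) (hint : (interior (region c θ)).Nonempty) :
    InjOn c (Ico 0 ℓ ∩ {s | 0 < q s}) := by
  obtain ⟨p, hp⟩ := hint
  intro s hs s' hs' hc
  exact h.eq_of_ray (slack_pos_of_mem_interior subset_rfl hp) hs.1 hs'.1 hs.2 hs'.2 one_pos
    (by simp [hc])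

/-! ### Area enclosed by a closed convex curve -/

/-- The real determinant of `x + iy ↦ x a + y b`. -/
theorem det_re_smulRight_add_im_smulRight (a b : ℂ) :
    (Complex.reCLM.smulRight a + Complex.imCLM.smulRight b).det = a.re * b.im - a.im * b.re := by
  rw [ContinuousLinearMap.det, ← LinearMap.det_toMatrix Complex.basisOneI, Matrix.det_fin_two]
  simp [LinearMap.toMatrix_apply]
  ring

theorem IsOval.continuous (h : IsOval c θ q ℓ) : Continuous c :=
  continuous_iff_continuousAt.2 fun s => (h.hasDerivAt s).continuousAt

theorem IsOval.continuous_slack (h : IsOval c θ q ℓ) (p : ℂ) : Continuous (slack c θ p) := by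
  have hc := h.continuous
  have hθ := h.continuous_angle
  unfold slack
  fun_prop

/-- The nonnegative integrand may be restricted to the part of a period where the curve moves. -/
theorem IsOval.setLIntegral_moving (h : IsOval c θ q ℓ) {f : ℝ → ℝ} (hf : Continuous f)
    (hf0 : ∀ s, 0 ≤ f s) :
    ∫⁻ s in Ico 0 ℓ ∩ {s | 0 < q s}, ENNReal.ofReal (q s * f s)
      = ENNReal.ofReal (∫ s in (0 : ℝ)..ℓ, q s * f s) := by
  have hm : MeasurableSet {s | 0 < q s} := (isOpen_lt continuous_const h.continuous_speed).measurableSet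
  have hc : Continuous fun s => q s * f s := h.continuous_speed.mul hf
  rw [intervalIntegral.integral_of_le h.length_pos.le,
    ofReal_integral_eq_lintegral_ofReal
      ((hc.integrableOn_Icc (a := 0) (b := ℓ)).mono_set Ioc_subset_Icc_self)
      (Filter.Eventually.of_forall fun s => mul_nonneg (h.speed_nonneg s) (hf0 s)),
    ← setLIntegral_congr (Ico_ae_eq_Ioc (a := (0 : ℝ)) (b := ℓ)),
    inter_comm, ← Measure.restrict_restrict hm, ← lintegral_indicator hm]
  refine lintegral_congr fun s => ?_
  by_cases hs : 0 < q s
  · simp [hs]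
  · simp [le_antisymm (not_lt.1 hs) (h.speed_nonneg s)]

/-- Parametrizing the region by the cone over the curve with apex `p`; the Jacobian at
`(s, r)` is `r q(s) slack(p, s)`. The part of the cone where it vanishes is negligible by Sard's
theorem, and on the rest the parametrization is injective. -/
theorem IsOval.volume_region (h : IsOval c θ q ℓ) {p : ℂ} (hp : p ∈ interior (region c θ)) :
    volume (region c θ)
      = ENNReal.ofReal (2⁻¹ * ∫ s in (0 : ℝ)..ℓ, q s * slack c θ p s) := by
  have hpos := slack_pos_of_mem_interior subset_rfl hp
  set F : ℂ → ℂ := fun u => p + u.im * (c u.re - p) with hF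
  set F' : ℂ → ℂ →L[ℝ] ℂ := fun u => Complex.reCLM.smulRight (u.im * (q u.re *
    Complex.exp (θ u.re * I))) + Complex.imCLM.smulRight (c u.re - p) with hF'
  have hd : ∀ u, HasFDerivAt F (F' u) u := by
    intro u
    have h1 : HasFDerivAt (fun u : ℂ => c u.re - p)
        (Complex.reCLM.smulRight (q u.re * Complex.exp (θ u.re * I))) u := by
      have := ((h.hasDerivAt u.re).hasFDerivAt.comp u Complex.reCLM.hasFDerivAt).sub_const p
      refine this.congr_fderiv ?_
      ext v
      simp
    have h2 : HasFDerivAt (fun u : ℂ => (u.im : ℂ))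
        (Complex.ofRealCLM.comp Complex.imCLM) u :=
      Complex.ofRealCLM.hasFDerivAt.comp u Complex.imCLM.hasFDerivAt
    refine ((h2.mul h1).const_add p).congr_fderiv ?_
    ext v
    simp [hF']
    ring
  have hdet : ∀ u, (F' u).det = -(u.im * (q u.re * slack c θ p u.re)) := by
    intro u
    rw [hF', det_re_smulRight_add_im_smulRight, slack_eq]
    simp only [Complex.mul_re, Complex.mul_im, Complex.exp_ofReal_mul_I_re,
      Complex.exp_ofReal_mul_I_im, Complex.ofReal_re, Complex.ofReal_im]
    ring
  have hq := h.continuous_speed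
  have hmS : MeasurableSet (Ico 0 ℓ ∩ {s | 0 < q s}) :=
    measurableSet_Ico.inter (isOpen_lt continuous_const hq).measurableSet
  set T : Set ℂ := Complex.measurableEquivRealProd ⁻¹'
    ((Ico 0 ℓ ∩ {s | 0 < q s}) ×ˢ Ioc (0 : ℝ) 1) with hT
  have hmT : MeasurableSet T :=
    Complex.measurableEquivRealProd.measurable (hmS.prod measurableSet_Ioc)
  set N : Set ℂ := {u | (F' u).det = 0} with hN
  have hnull : volume (F '' N) = 0 :=
    addHaar_image_eq_zero_of_det_fderivWithin_eq_zero volume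
      (fun u _ => (hd u).hasFDerivWithinAt) (fun u hu => hu)
  have hsub : F '' T ⊆ region c θ := by
    rw [h.region_eq_cone hp]
    rintro _ ⟨u, hu, rfl⟩
    exact ⟨u.re, hu.1.1, u.im, ⟨hu.2.1.le, hu.2.2⟩, rfl⟩
  have hsup : region c θ ⊆ F '' T ∪ F '' N := by
    rw [h.region_eq_cone hp, ← image_union]
    rintro _ ⟨s, hs, r, hr, rfl⟩
    refine ⟨⟨s, r⟩, ?_, rfl⟩
    by_cases h0 : r = 0 ∨ q s = 0
    · refine Or.inr ?_
      rw [hN, mem_ofPred_eq, hdet]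
      rcases h0 with h0 | h0 <;> simp [h0]
    · push Not at h0
      exact Or.inl ⟨⟨hs, lt_of_le_of_ne (h.speed_nonneg s) h0.2.symm⟩,
        lt_of_le_of_ne hr.1 h0.1.symm, hr.2⟩
  have hvol : volume (region c θ) = volume (F '' T) := by
    refine le_antisymm ((measure_mono hsup).trans ((measure_union_le _ _).trans ?_))
      (measure_mono hsub)
    rw [hnull, add_zero]
  have hinj : InjOn F T := by
    intro u hu v hv huv
    have huv' : (u.im : ℂ) * (c u.re - p) = v.im * (c v.re - p) := by
      simpa [hF] using huv
    have hv0 : (v.im : ℂ) ≠ 0 := by exact_mod_cast hv.2.1.ne'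
    have hu1 : 0 < u.im := hu.2.1
    have hv1 : 0 < v.im := hv.2.1
    have hre : u.re = v.re := by
      refine h.eq_of_ray hpos hu.1.1 hv.1.1 hu.1.2 hv.1.2 (div_pos hu1 hv1) ?_
      push_cast
      field_simp
      linear_combination -huv'
    rw [hre] at huv'
    have := mul_right_cancel₀ (slack_ne_zero_imp_ne (hpos v.re).ne') huv'
    exact Complex.ext hre (by exact_mod_cast this)
  have hhalf : ∫⁻ r in Ioc (0 : ℝ) 1, ENNReal.ofReal r = ENNReal.ofReal 2⁻¹ := by
    rw [← ofReal_integral_eq_lintegral_ofReal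
      (f := fun r : ℝ => r)
      ((continuous_id.integrableOn_Icc (a := (0 : ℝ)) (b := 1)).mono_set Ioc_subset_Icc_self)
      ((ae_restrict_iff' measurableSet_Ioc).2 (Filter.Eventually.of_forall fun r hr => hr.1.le)),
      ← intervalIntegral.integral_of_le zero_le_one]
    norm_num
  rw [hvol, ← lintegral_abs_det_fderiv_eq_addHaar_image volume hmT
    (fun u _ => (hd u).hasFDerivWithinAt) hinj, ENNReal.ofReal_mul (by norm_num), ← hhalf,
    ← h.setLIntegral_moving (h.continuous_slack p) (fun s => (hpos s).le), mul_comm]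
  rw [← lintegral_prod_mul, Measure.prod_restrict, ← Measure.volume_eq_prod,
    ← Complex.volume_preserving_equiv_real_prod.setLIntegral_comp_preimage
      (hmS.prod measurableSet_Ioc)]
  · refine setLIntegral_congr_fun hmT fun u hu => ?_
    have h1 : 0 ≤ q u.re * slack c θ p u.re := mul_nonneg (h.speed_nonneg _) (hpos _).le
    change ENNReal.ofReal |(F' u).det|
      = ENNReal.ofReal (q u.re * slack c θ p u.re) * ENNReal.ofReal u.im
    have hu1 : 0 < u.im := hu.2.1
    rw [hdet, abs_neg, abs_of_nonneg (mul_nonneg hu1.le h1), mul_comm, ENNReal.ofReal_mul h1]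
  · have hs := h.continuous_slack p
    fun_prop
  · exact (hq.mul (h.continuous_slack p)).measurable.ennreal_ofReal.aemeasurable
  · exact ENNReal.measurable_ofReal.aemeasurable

/-! ### Length of a closed convex curve -/

theorem IsOval.hausdorffMeasure_le (h : IsOval c θ q ℓ) :
    Measure.hausdorffMeasure 1 (c '' Ico 0 ℓ) ≤ ENNReal.ofReal (∫ s in (0 : ℝ)..ℓ, q s) := by
  have hq := h.continuous_speed
  set σ : ℝ → ℝ := fun s => ∫ x in (0 : ℝ)..s, q x with hσ
  have hσd : ∀ s, HasDerivAt σ (q s) s := fun s => (hq.integral_hasStrictDerivAt 0 s).hasDerivAt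
  have hσ0 : σ 0 = 0 := by simp [hσ]
  have hσc : Continuous σ := continuous_iff_continuousAt.2 fun s => (hσd s).continuousAt
  have hσm : Monotone σ := monotone_of_deriv_nonneg (fun s => (hσd s).differentiableAt)
    fun s => by rw [(hσd s).deriv]; exact h.speed_nonneg s
  have hle : ∀ a b, a ≤ b → dist (c a) (c b) ≤ dist (σ a) (σ b) := by
    intro a b hab
    rw [dist_comm, dist_comm (σ a), Real.dist_eq, abs_of_nonneg (sub_nonneg.2 (hσm hab)),
      dist_eq_norm]
    have := image_norm_le_of_norm_deriv_right_le_deriv_boundary' (f := fun s => c s - c a)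
      (f' := fun s => q s * Complex.exp (θ s * I)) (a := a) (b := b)
      (B := fun s => σ s - σ a) (B' := q)
      (h.continuous.sub continuous_const).continuousOn
      (fun s _ => ((h.hasDerivAt s).sub_const _).hasDerivWithinAt) (by simp)
      (hσc.sub continuous_const).continuousOn
      (fun s _ => ((hσd s).sub_const _).hasDerivWithinAt)
      (fun s _ => by
        rw [norm_mul, Complex.norm_exp_ofReal_mul_I, mul_one, Complex.norm_real, Real.norm_eq_abs,
          abs_of_nonneg (h.speed_nonneg s)])
    exact this ⟨hab, le_rfl⟩
  have hle' : ∀ a b, dist (c a) (c b) ≤ dist (σ a) (σ b) := by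
    intro a b
    rcases le_total a b with hab | hab
    · exact hle a b hab
    · rw [dist_comm, dist_comm (σ a)]; exact hle b a hab
  -- `c` factors through the arc length `σ` as a `1`-Lipschitz map
  have hsurj : ∀ y ∈ Icc 0 (σ ℓ), ∃ s, σ s = y := by
    intro y hy
    obtain ⟨s, -, hs⟩ := intermediate_value_Icc h.length_pos.le hσc.continuousOn
      (by rw [hσ0]; exact hy)
    exact ⟨s, hs⟩
  choose! g hg using hsurj
  have hlip : LipschitzOnWith 1 (fun y => c (g y)) (Icc 0 (σ ℓ)) := by
    refine LipschitzOnWith.of_dist_le_mul fun y hy z hz => ?_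
    simpa [hg y hy, hg z hz] using hle' (g y) (g z)
  have hsub : c '' Ico 0 ℓ ⊆ (fun y => c (g y)) '' Icc 0 (σ ℓ) := by
    rintro _ ⟨s, hs, rfl⟩
    have hmem : σ s ∈ Icc 0 (σ ℓ) := ⟨hσ0 ▸ hσm hs.1, hσm hs.2.le⟩
    refine ⟨σ s, hmem, ?_⟩
    have := hle' (g (σ s)) s
    rw [hg _ hmem, dist_self] at this
    exact dist_le_zero.1 this
  calc Measure.hausdorffMeasure 1 (c '' Ico 0 ℓ)
      ≤ Measure.hausdorffMeasure 1 ((fun y => c (g y)) '' Icc 0 (σ ℓ)) := measure_mono hsub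
    _ ≤ Measure.hausdorffMeasure 1 (Icc 0 (σ ℓ)) := by
        simpa using hlip.hausdorffMeasure_image_le (d := 1) zero_le_one
    _ = ENNReal.ofReal (∫ s in (0 : ℝ)..ℓ, q s) := by
        rw [hausdorffMeasure_real, Real.volume_Icc, sub_zero]

/-- An arc along which the tangent angle stays within `ε` of `α` is at least as long as
`cos ε` times the integral of the speed: project it orthogonally to the direction `α`. -/
theorem IsOval.lintegral_le_hausdorffMeasure (h : IsOval c θ q ℓ) {ε α : ℝ}
    (hε : ε ≤ Real.pi / 2) {A S : Set ℝ} (hA : A.OrdConnected) (hS : MeasurableSet S)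
    (hSA : S ⊆ A) (hα : ∀ s ∈ A, |θ s - α| ≤ ε) :
    ENNReal.ofReal (Real.cos ε) * ∫⁻ s in S, ENNReal.ofReal (q s)
      ≤ Measure.hausdorffMeasure 1 (c '' S) := by
  set f : ℝ → ℝ := fun s => (c s * Complex.exp (-α * I)).re with hf
  have hd : ∀ s, HasDerivAt f (q s * Real.cos (θ s - α)) s := by
    intro s
    have h1 := Complex.reCLM.hasFDerivAt.comp_hasDerivAt s
      ((h.hasDerivAt s).mul_const (Complex.exp (-α * I)))
    refine h1.congr_deriv ?_
    rw [mul_assoc, ← Complex.exp_add, ← add_mul, Complex.reCLM_apply, Complex.re_ofReal_mul,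
      ← Complex.exp_ofReal_mul_I_re]
    push_cast
    rfl
  have hcos : ∀ s ∈ A, Real.cos ε ≤ Real.cos (θ s - α) := fun s hs => by
    rw [← Real.cos_abs (θ s - α)]
    exact Real.cos_le_cos_of_nonneg_of_le_pi (abs_nonneg _) (by linarith [Real.pi_pos]) (hα s hs)
  have hmono : MonotoneOn f A := by
    apply monotoneOn_of_deriv_nonneg hA.convex
    · exact fun s _ => (hd s).continuousAt.continuousWithinAt
    · exact fun s _ => (hd s).differentiableAt.differentiableWithinAt
    · intro s hs
      have hs := interior_subset hs
      rw [(hd s).deriv]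
      have hε0 : 0 ≤ ε := (abs_nonneg _).trans (hα s hs)
      exact mul_nonneg (h.speed_nonneg s) ((Real.cos_nonneg_of_mem_Icc
        ⟨by linarith [Real.pi_pos], hε⟩).trans (hcos s hs))
  have hlip : LipschitzWith 1 fun z : ℂ => (z * Complex.exp (-α * I)).re := by
    refine LipschitzWith.of_dist_le_mul fun z w => ?_
    rw [Real.dist_eq, ← Complex.sub_re, ← sub_mul, dist_eq_norm, NNReal.coe_one, one_mul]
    refine (Complex.abs_re_le_norm _).trans ?_
    rw [norm_mul, ← Complex.ofReal_neg, Complex.norm_exp_ofReal_mul_I, mul_one]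
  calc ENNReal.ofReal (Real.cos ε) * ∫⁻ s in S, ENNReal.ofReal (q s)
      = ∫⁻ s in S, ENNReal.ofReal (Real.cos ε) * ENNReal.ofReal (q s) := by
        rw [lintegral_const_mul]
        exact h.continuous_speed.measurable.ennreal_ofReal
    _ ≤ ∫⁻ s in S, ENNReal.ofReal (q s * Real.cos (θ s - α)) := by
        refine setLIntegral_mono' hS fun s hs => ?_
        rw [mul_comm, ← ENNReal.ofReal_mul (h.speed_nonneg s)]
        exact ENNReal.ofReal_le_ofReal
          (mul_le_mul_of_nonneg_left (hcos s (hSA hs)) (h.speed_nonneg s))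
    _ = volume (f '' S) := lintegral_deriv_eq_volume_image_of_monotoneOn hS
        (fun s _ => (hd s).hasDerivWithinAt) (hmono.mono hSA)
    _ = Measure.hausdorffMeasure 1 ((fun z : ℂ => (z * Complex.exp (-α * I)).re) '' (c '' S)) := by
        rw [hausdorffMeasure_real, image_image]
    _ ≤ Measure.hausdorffMeasure 1 (c '' S) := by
        simpa using hlip.hausdorffMeasure_image_le (d := 1) zero_le_one (c '' S)

theorem IsOval.cos_mul_le_hausdorffMeasure (h : IsOval c θ q ℓ)
    (hint : (interior (region c θ)).Nonempty) {ε : ℝ} (hε0 : 0 < ε) (hε : ε ≤ Real.pi / 2) :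
    ENNReal.ofReal (Real.cos ε) * ENNReal.ofReal (∫ s in (0 : ℝ)..ℓ, q s)
      ≤ Measure.hausdorffMeasure 1 (c '' Ico 0 ℓ) := by
  set S : Set ℝ := Ico 0 ℓ ∩ {s | 0 < q s} with hS
  have hmS : MeasurableSet S :=
    measurableSet_Ico.inter (isOpen_lt continuous_const h.continuous_speed).measurableSet
  have hθ := h.continuous_angle
  -- cut the period into pieces along which the angle varies by less than `ε`
  set A : ℤ → Set ℝ := fun i => {s | ⌊θ s / ε⌋ = i} with hA
  have hAm : ∀ i, MeasurableSet (A i) := fun i =>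
    (Int.measurable_floor.comp (hθ.measurable.div_const ε)) (measurableSet_singleton i)
  have hAo : ∀ i, (A i).OrdConnected := fun i => by
    refine ⟨fun x hx y hy z hz => ?_⟩
    have hm : Monotone fun s => ⌊θ s / ε⌋ := fun a b hab =>
      Int.floor_mono (div_le_div_of_nonneg_right (h.angle_mono hab) hε0.le)
    exact le_antisymm ((hm hz.2).trans_eq hy) (hx.symm.trans_le (hm hz.1))
  have hdisj : Pairwise (Function.onFun Disjoint fun i => S ∩ A i) := by
    intro i j hij
    refine disjoint_left.2 fun s hs hs' => hij ?_
    exact hs.2.symm.trans hs'.2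
  have hunion : ⋃ i, S ∩ A i = S := by
    rw [← inter_iUnion]
    exact inter_eq_left.2 fun s _ => mem_iUnion.2 ⟨_, rfl⟩
  have hinj : InjOn c S := h.injOn hint
  have hmeas : ∀ i, MeasurableSet (c '' (S ∩ A i)) := fun i =>
    (hmS.inter (hAm i)).image_of_continuousOn_injOn h.continuous.continuousOn
      (hinj.mono inter_subset_left)
  have hdisj' : Pairwise (Function.onFun Disjoint fun i => c '' (S ∩ A i)) := by
    intro i j hij
    refine disjoint_left.2 ?_
    rintro _ ⟨s, hs, rfl⟩ ⟨s', hs', hss⟩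
    obtain rfl := hinj hs'.1 hs.1 hss
    exact disjoint_left.1 (hdisj hij) hs hs'
  have hone := h.setLIntegral_moving (f := fun _ => 1) continuous_const fun _ => zero_le_one
  simp only [mul_one] at hone
  calc ENNReal.ofReal (Real.cos ε) * ENNReal.ofReal (∫ s in (0 : ℝ)..ℓ, q s)
      = ENNReal.ofReal (Real.cos ε) * ∫⁻ s in ⋃ i, S ∩ A i, ENNReal.ofReal (q s) := by
        rw [hunion, hone]
    _ = ∑' i, ENNReal.ofReal (Real.cos ε) * ∫⁻ s in S ∩ A i, ENNReal.ofReal (q s) := by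
        rw [lintegral_iUnion (fun i => hmS.inter (hAm i)) hdisj, ENNReal.tsum_mul_left]
    _ ≤ ∑' i, Measure.hausdorffMeasure 1 (c '' (S ∩ A i)) := by
        refine ENNReal.tsum_le_tsum fun i => ?_
        refine h.lintegral_le_hausdorffMeasure (α := i * ε) hε (hAo i) (hmS.inter (hAm i))
          inter_subset_right fun s hs => ?_
        have h1 := (Int.floor_eq_iff.1 hs).1
        have h2 := (Int.floor_eq_iff.1 hs).2
        rw [le_div_iff₀ hε0] at h1
        rw [div_lt_iff₀ hε0] at h2
        rw [abs_le]
        constructor <;> linarith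
    _ = Measure.hausdorffMeasure 1 (⋃ i, c '' (S ∩ A i)) := (measure_iUnion hdisj' hmeas).symm
    _ ≤ Measure.hausdorffMeasure 1 (c '' Ico 0 ℓ) := by
        rw [← image_iUnion, hunion]
        exact measure_mono (image_mono inter_subset_left)

theorem IsOval.hausdorffMeasure_frontier (h : IsOval c θ q ℓ)
    (hint : (interior (region c θ)).Nonempty) :
    Measure.hausdorffMeasure 1 (frontier (region c θ))
      = ENNReal.ofReal (∫ s in (0 : ℝ)..ℓ, q s) := by
  rw [h.frontier_region hint]
  refine le_antisymm h.hausdorffMeasure_le ?_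
  have hlim : Filter.Tendsto (fun ε => ENNReal.ofReal (Real.cos ε) *
      ENNReal.ofReal (∫ s in (0 : ℝ)..ℓ, q s)) (nhdsWithin 0 (Ioi 0))
      (nhds (ENNReal.ofReal (∫ s in (0 : ℝ)..ℓ, q s))) := by
    have h1 : Filter.Tendsto (fun ε => ENNReal.ofReal (Real.cos ε)) (nhdsWithin 0 (Ioi 0))
        (nhds 1) := by
      have := (ENNReal.continuous_ofReal.comp Real.continuous_cos).tendsto 0
      simp only [Function.comp_def, Real.cos_zero, ENNReal.ofReal_one] at this
      exact this.mono_left nhdsWithin_le_nhds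
    simpa using ENNReal.Tendsto.mul_const h1 (Or.inl one_ne_zero)
  refine le_of_tendsto hlim ?_
  filter_upwards [Ioo_mem_nhdsGT (half_pos Real.pi_pos)] with ε hε
  exact h.cos_mul_le_hausdorffMeasure hint hε.1 hε.2.le

/-! ### The isoperimetric inequality with its equality case -/

section Fourier

variable {f g : ℝ → ℂ} {ℓ : ℝ}

theorem fourierCoeffOn_linear_comb (hℓ : 0 < ℓ) (hf : Continuous f) (hg : Continuous g) (α β : ℂ)
    (n : ℤ) : fourierCoeffOn hℓ (fun s => α * f s + β * g s) n
      = α * fourierCoeffOn hℓ f n + β * fourierCoeffOn hℓ g n := by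
  have hc : Continuous fun x : ℝ => (fourier (-n) (x : AddCircle (ℓ - 0)) : ℂ) :=
    (map_continuous (fourier (-n))).comp (AddCircle.continuous_mk' _)
  rw [← fourierCoeffOn.const_mul, ← fourierCoeffOn.const_mul]
  simp only [fourierCoeffOn_eq_integral, smul_eq_mul, mul_add]
  rw [intervalIntegral.integral_add, smul_add]
  · exact (by fun_prop : Continuous _).intervalIntegrable _ _
  · exact (by fun_prop : Continuous _).intervalIntegrable _ _

theorem hasSum_sq_fourierCoeffOn_of_continuous (hℓ : 0 < ℓ) (hf : Continuous f) :
    HasSum (fun n => ‖fourierCoeffOn hℓ f n‖ ^ 2) (ℓ⁻¹ * ∫ s in (0 : ℝ)..ℓ, ‖f s‖ ^ 2) := by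
  have h := hasSum_sq_fourierCoeffOn (f := f) hℓ ((memLp_two_iff_integrable_sq_norm
    hf.aestronglyMeasurable).2 (((hf.norm.pow 2).integrableOn_Icc).mono_set Ioc_subset_Icc_self))
  simpa using h

theorem fourierCoeffOn_zero (hℓ : 0 < ℓ) :
    fourierCoeffOn hℓ f 0 = (ℓ : ℂ)⁻¹ * ∫ s in (0 : ℝ)..ℓ, f s := by
  simp [fourierCoeffOn_eq_integral]

theorem fourierCoeffOn_deriv (hℓ : 0 < ℓ) (hd : ∀ s, HasDerivAt f (g s) s) (hg : Continuous g)
    (hper : f ℓ = f 0) (n : ℤ) :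
    fourierCoeffOn hℓ g n = I * (2 * Real.pi / ℓ : ℝ) * n * fourierCoeffOn hℓ f n := by
  have hℓ0 : (ℓ : ℂ) ≠ 0 := by exact_mod_cast hℓ.ne'
  rcases eq_or_ne n 0 with rfl | hn
  · rw [fourierCoeffOn_zero, intervalIntegral.integral_eq_sub_of_hasDerivAt (fun s _ => hd s)
      (hg.intervalIntegrable _ _), hper]
    simp
  · have h := fourierCoeffOn_of_hasDerivAt hℓ hn (fun s _ => hd s) (hg.intervalIntegrable _ _)
    have hn' : (n : ℂ) ≠ 0 := by exact_mod_cast hn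
    have hpi : (Real.pi : ℂ) ≠ 0 := by exact_mod_cast Real.pi_ne_zero
    rw [h, hper]
    push_cast
    field_simp
    ring_nf

/-- The isoperimetric deficit of a closed unit speed curve as a series of nonnegative terms in the
Fourier coefficients: Parseval's identity for `c` and for `2 c' - i a c`, where `a = 2 π / ℓ`. -/
theorem hasSum_isoperimetric_deficit (hℓ : 0 < ℓ) (hd : ∀ s, HasDerivAt f (g s) s)
    (hg : Continuous g) (hper : f ℓ = f 0) (hunit : ∀ s, ‖g s‖ = 1) :
    HasSum (fun n : ℤ => (2 * Real.pi / ℓ) ^ 2 * ((2 * n - 1) ^ 2 - 1)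
        * ‖fourierCoeffOn hℓ f n‖ ^ 2)
      (ℓ⁻¹ * (4 * ℓ - 4 * (2 * Real.pi / ℓ) * ∫ s in (0 : ℝ)..ℓ, (conj (f s) * g s).im)) := by
  have hf : Continuous f := continuous_iff_continuousAt.2 fun s => (hd s).continuousAt
  set a : ℝ := 2 * Real.pi / ℓ with ha
  have h1 := hasSum_sq_fourierCoeffOn_of_continuous hℓ hf
  have h2 := hasSum_sq_fourierCoeffOn_of_continuous (f := fun s => 2 * g s + (-(I * a)) * f s) hℓ
    (by fun_prop)
  have h3 := h2.sub (h1.mul_left (a ^ 2))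
  have hterm : ∀ n : ℤ, a ^ 2 * ((2 * (n : ℝ) - 1) ^ 2 - 1) * ‖fourierCoeffOn hℓ f n‖ ^ 2
      = ‖fourierCoeffOn hℓ (fun s => 2 * g s + (-(I * a)) * f s) n‖ ^ 2
        - a ^ 2 * ‖fourierCoeffOn hℓ f n‖ ^ 2 := by
    intro n
    rw [fourierCoeffOn_linear_comb hℓ hg hf, fourierCoeffOn_deriv hℓ hd hg hper]
    have : 2 * (I * (2 * Real.pi / ℓ : ℝ) * n * fourierCoeffOn hℓ f n)
        + -(I * a) * fourierCoeffOn hℓ f n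
        = I * ((a * (2 * n - 1) : ℝ) : ℂ) * fourierCoeffOn hℓ f n := by
      rw [← ha]
      push_cast
      ring
    rw [this, norm_mul, norm_mul, Complex.norm_I, Complex.norm_real, Real.norm_eq_abs, mul_pow,
      mul_pow, sq_abs]
    ring
  have hval : ℓ⁻¹ * (4 * ℓ - 4 * a * ∫ s in (0 : ℝ)..ℓ, (conj (f s) * g s).im)
      = ℓ⁻¹ * (∫ s in (0 : ℝ)..ℓ, ‖2 * g s + (-(I * a)) * f s‖ ^ 2)
        - a ^ 2 * (ℓ⁻¹ * ∫ s in (0 : ℝ)..ℓ, ‖f s‖ ^ 2) := by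
    have hpt : ∀ s, ‖2 * g s + (-(I * a)) * f s‖ ^ 2
        = 4 - 4 * a * (conj (f s) * g s).im + a ^ 2 * ‖f s‖ ^ 2 := by
      intro s
      have hu : (g s).re * (g s).re + (g s).im * (g s).im = 1 := by
        rw [← Complex.normSq_apply, Complex.normSq_eq_norm_sq, hunit, one_pow]
      rw [← Complex.normSq_eq_norm_sq, ← Complex.normSq_eq_norm_sq, Complex.normSq_apply,
        Complex.normSq_apply]
      simp only [Complex.add_re, Complex.add_im, Complex.mul_re, Complex.mul_im, Complex.neg_re,
        Complex.neg_im, Complex.I_re, Complex.I_im, Complex.ofReal_re, Complex.ofReal_im,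
        Complex.conj_re, Complex.conj_im, Complex.re_ofNat, Complex.im_ofNat]
      linear_combination 4 * hu
    have hi1 : Continuous fun s => (conj (f s) * g s).im := by fun_prop
    have hi2 : Continuous fun s => ‖f s‖ ^ 2 := by fun_prop
    simp only [hpt]
    rw [intervalIntegral.integral_add, intervalIntegral.integral_sub,
      intervalIntegral.integral_const_mul, intervalIntegral.integral_const_mul]
    · simp
      ring
    all_goals exact (by fun_prop : Continuous _).intervalIntegrable _ _
  simp only [hterm, hval]
  exact h3

theorem deficit_term_nonneg (n : ℤ) (x : ℝ) :
    0 ≤ (2 * Real.pi / ℓ) ^ 2 * ((2 * (n : ℝ) - 1) ^ 2 - 1) * x ^ 2 := by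
  have h : (0 : ℤ) ≤ (2 * n - 1) ^ 2 - 1 := by
    rcases le_or_gt n 0 with h | h <;> nlinarith
  have h' : (0 : ℝ) ≤ (2 * (n : ℝ) - 1) ^ 2 - 1 := by exact_mod_cast h
  positivity

/-- The isoperimetric inequality `4 π V ≤ ℓ²` for a closed unit speed curve, where
`2 V = ∫ Im (c̄ c')`. -/
theorem isoperimetric_le (hℓ : 0 < ℓ) (hd : ∀ s, HasDerivAt f (g s) s)
    (hg : Continuous g) (hper : f ℓ = f 0) (hunit : ∀ s, ‖g s‖ = 1) :
    2 * Real.pi * ∫ s in (0 : ℝ)..ℓ, (conj (f s) * g s).im ≤ ℓ ^ 2 := by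
  have h := (hasSum_isoperimetric_deficit hℓ hd hg hper hunit).nonneg
    fun n => deficit_term_nonneg n _
  have h2 : 0 ≤ 4 * ℓ - 4 * (2 * Real.pi / ℓ) * ∫ s in (0 : ℝ)..ℓ, (conj (f s) * g s).im :=
    nonneg_of_mul_nonneg_right h (inv_pos.2 hℓ)
  have h3 : ℓ * (4 * ℓ - 4 * (2 * Real.pi / ℓ) * ∫ s in (0 : ℝ)..ℓ, (conj (f s) * g s).im)
      = 4 * (ℓ ^ 2 - 2 * Real.pi * ∫ s in (0 : ℝ)..ℓ, (conj (f s) * g s).im) := by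
    field_simp
  have h4 := mul_nonneg hℓ.le h2
  linarith

/-- In the case of equality only the Fourier modes `0` and `1` survive, so that `c' = i a c` for a
curve with mean zero. -/
theorem deriv_eq_of_isoperimetric_eq (hℓ : 0 < ℓ) (hd : ∀ s, HasDerivAt f (g s) s)
    (hg : Continuous g) (hper : f ℓ = f 0) (hunit : ∀ s, ‖g s‖ = 1)
    (hmean : ∫ s in (0 : ℝ)..ℓ, f s = 0)
    (heq : 2 * Real.pi * ∫ s in (0 : ℝ)..ℓ, (conj (f s) * g s).im = ℓ ^ 2)
    {s : ℝ} (hs : s ∈ Icc 0 ℓ) : g s = I * (2 * Real.pi / ℓ : ℝ) * f s := by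
  have hf : Continuous f := continuous_iff_continuousAt.2 fun s => (hd s).continuousAt
  have h := hasSum_isoperimetric_deficit hℓ hd hg hper hunit
  have h0 : ℓ⁻¹ * (4 * ℓ - 4 * (2 * Real.pi / ℓ) * ∫ s in (0 : ℝ)..ℓ, (conj (f s) * g s).im)
      = 0 := by
    have : 4 * ℓ - 4 * (2 * Real.pi / ℓ) * ∫ s in (0 : ℝ)..ℓ, (conj (f s) * g s).im = 0 := by
      field_simp
      linarith
    rw [this, mul_zero]
  rw [h0, hasSum_zero_iff_of_nonneg fun n => deficit_term_nonneg n _] at h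
  have hcoef : ∀ n : ℤ, n ≠ 1 → fourierCoeffOn hℓ f n = 0 := by
    intro n hn
    rcases eq_or_ne n 0 with rfl | hn0
    · rw [fourierCoeffOn_zero, hmean, mul_zero]
    · have hn' := congrFun h n
      have ha : (2 * Real.pi / ℓ) ^ 2 ≠ 0 := by positivity
      have hk : (2 * (n : ℝ) - 1) ^ 2 - 1 ≠ 0 := by
        have : (2 * (n : ℝ) - 1) ^ 2 - 1 = 4 * (n * (n - 1)) := by ring
        rw [this]
        refine mul_ne_zero four_ne_zero (mul_ne_zero (by exact_mod_cast hn0) ?_)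
        rw [sub_ne_zero]
        exact_mod_cast hn
      simpa [ha, hk, Real.pi_ne_zero, hℓ.ne'] using hn'
  have hc : Continuous fun s => 1 * g s + -(I * (2 * Real.pi / ℓ : ℝ)) * f s := by fun_prop
  have h1 := hasSum_sq_fourierCoeffOn_of_continuous hℓ hc
  have hz : (fun n => ‖fourierCoeffOn hℓ
      (fun s => 1 * g s + -(I * (2 * Real.pi / ℓ : ℝ)) * f s) n‖ ^ 2) = fun _ => 0 := by
    ext n
    rw [fourierCoeffOn_linear_comb hℓ hg hf, fourierCoeffOn_deriv hℓ hd hg hper]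
    rcases eq_or_ne n 1 with rfl | hn
    · simp
    · simp [hcoef n hn]
  rw [hz] at h1
  have h2 := h1.unique hasSum_zero
  have h3 : ∫ s in (0 : ℝ)..ℓ, ‖1 * g s + -(I * (2 * Real.pi / ℓ : ℝ)) * f s‖ ^ 2 = 0 := by
    simpa [hℓ.ne'] using h2
  by_contra hne
  refine h3.not_gt (intervalIntegral.integral_pos hℓ (hc.norm.pow 2).continuousOn
    (fun _ _ => by positivity) ⟨s, hs, ?_⟩)
  have : 1 * g s + -(I * (2 * Real.pi / ℓ : ℝ)) * f s ≠ 0 := by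
    intro h
    exact hne (by linear_combination h)
  positivity

end Fourier

/-- The isoperimetric inequality is strict unless the curve is a circle, traced once with constant
angle between the velocity and the position vector from the centre. -/
theorem isoperimetric_lt {f g : ℝ → ℂ} {ℓ : ℝ} (hℓ : 0 < ℓ) (hd : ∀ s, HasDerivAt f (g s) s)
    (hg : Continuous g) (hper : f ℓ = f 0) (hunit : ∀ s, ‖g s‖ = 1)
    (hcircle : ¬ ∃ (x₀ : ℂ) (R : ℝ), ∀ s ∈ Icc 0 ℓ, f s = x₀ - R * (I * g s)) (p : ℂ) :
    2 * Real.pi * ∫ s in (0 : ℝ)..ℓ, (conj (f s - p) * g s).im < ℓ ^ 2 := by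
  have hf : Continuous f := continuous_iff_continuousAt.2 fun s => (hd s).continuousAt
  have hgi : ∫ s in (0 : ℝ)..ℓ, g s = 0 := by
    rw [intervalIntegral.integral_eq_sub_of_hasDerivAt (fun s _ => hd s)
      (hg.intervalIntegrable _ _), hper, sub_self]
  -- the left-hand side does not depend on `p`
  have hshift : ∀ x : ℂ, ∫ s in (0 : ℝ)..ℓ, (conj (f s - x) * g s).im
      = ∫ s in (0 : ℝ)..ℓ, (conj (f s) * g s).im := by
    intro x
    have h1 : ∫ s in (0 : ℝ)..ℓ, (conj x * g s).im = 0 := by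
      have := Complex.imCLM.intervalIntegral_comp_comm
        ((hg.const_mul (conj x)).intervalIntegrable 0 ℓ (μ := volume))
      rw [intervalIntegral.integral_const_mul, hgi, mul_zero, map_zero] at this
      simpa using this
    have h2 : ∀ s, (conj (f s - x) * g s).im = (conj (f s) * g s).im - (conj x * g s).im := by
      intro s
      rw [map_sub, sub_mul, Complex.sub_im]
    have hc1 : Continuous fun s => (conj (f s) * g s).im := by fun_prop
    have hc2 : Continuous fun s => (conj x * g s).im := by fun_prop
    simp only [h2]
    rw [intervalIntegral.integral_sub (hc1.intervalIntegrable _ _) (hc2.intervalIntegrable _ _),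
      h1, sub_zero]
  rw [hshift]
  refine lt_of_le_of_ne (isoperimetric_le hℓ hd hg hper hunit) fun heq => hcircle ?_
  set x₀ : ℂ := (ℓ : ℂ)⁻¹ * ∫ s in (0 : ℝ)..ℓ, f s with hx₀
  have hℓ0 : (ℓ : ℂ) ≠ 0 := by exact_mod_cast hℓ.ne'
  have hmean : ∫ s in (0 : ℝ)..ℓ, (f s - x₀) = 0 := by
    rw [intervalIntegral.integral_sub (hf.intervalIntegrable _ _)
      (continuous_const.intervalIntegrable _ _), intervalIntegral.integral_const, hx₀]
    simp [hℓ0]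
  refine ⟨x₀, ℓ / (2 * Real.pi), fun s hs => ?_⟩
  have := deriv_eq_of_isoperimetric_eq hℓ (fun s => (hd s).sub_const x₀) hg (by rw [hper]) hunit
    hmean (by rw [hshift, heq]) hs
  have hpi : (Real.pi : ℂ) ≠ 0 := by exact_mod_cast Real.pi_ne_zero
  rw [this]
  push_cast
  field_simp
  linear_combination (f s - x₀) * Complex.I_sq

/-! ### Inner parallel curves -/

variable {k : ℝ → ℝ}

/-- The curve at distance `t` to the left of `c`. -/
noncomputable def offset (c : ℝ → ℂ) (θ : ℝ → ℝ) (t : ℝ) (s : ℝ) : ℂ :=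
  c s + t * (I * Complex.exp (θ s * I))

theorem hasDerivAt_tangent {θ' s : ℝ} (hθ : HasDerivAt θ θ' s) :
    HasDerivAt (fun s => Complex.exp (θ s * I)) (θ' * (I * Complex.exp (θ s * I))) s := by
  have := (hθ.ofReal_comp.mul_const I).cexp
  refine this.congr_deriv ?_
  ring

theorem slack_offset (t : ℝ) (x : ℂ) (s : ℝ) :
    slack (offset c θ t) θ x s = slack c θ x s - t := by
  rw [← slack_sub_normal]
  simp only [slack, offset, map_sub, map_add, map_mul, Complex.conj_ofReal, Complex.conj_I]
  simp only [Complex.mul_im, Complex.mul_re, Complex.sub_re, Complex.sub_im, Complex.add_re,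
    Complex.add_im, Complex.conj_re, Complex.conj_im, Complex.ofReal_re, Complex.ofReal_im,
    Complex.I_re, Complex.I_im, Complex.neg_re, Complex.neg_im]
  ring

theorem mem_region_offset {t : ℝ} {x : ℂ} :
    x ∈ region (offset c θ t) θ ↔ ∀ s, t ≤ slack c θ x s := by
  simp [region, slack_offset]

theorem region_offset_subset {t : ℝ} (ht : 0 ≤ t) : region (offset c θ t) θ ⊆ region c θ :=
  fun _ hx s => ht.trans (mem_region_offset.1 hx s)

/-- As long as `t` is at most every radius of curvature `1 / k`, the offset of a convex unit speed
curve is again a closed convex curve, with speed `1 - t k`. -/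
theorem IsOval.isOval_offset (h : IsOval c θ (fun _ => 1) ℓ) (hθ : ∀ s, HasDerivAt θ (k s) s)
    (hk : Continuous k) {t : ℝ} (ht : ∀ s, t * k s ≤ 1) :
    IsOval (offset c θ t) θ (fun s => 1 - t * k s) ℓ where
  length_pos := h.length_pos
  hasDerivAt s := by
    refine ((h.hasDerivAt s).add (((hasDerivAt_tangent (hθ s)).const_mul I).const_mul
      (t : ℂ))).congr_deriv ?_
    push_cast
    linear_combination (t * k s * Complex.exp (θ s * I)) * Complex.I_sq
  continuous_speed := by fun_prop
  speed_nonneg s := sub_nonneg.2 (ht s)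
  continuous_angle := h.continuous_angle
  angle_mono := h.angle_mono
  angle_add := h.angle_add
  periodic s := by
    have : Complex.exp ((θ (s + ℓ) : ℝ) * I) = Complex.exp (θ s * I) := by
      rw [h.angle_add]
      push_cast
      rw [add_mul, Complex.exp_add, Complex.exp_two_pi_mul_I, mul_one]
    simp only [offset, h.periodic s, this]

theorem IsOval.integral_curvature (h : IsOval c θ q ℓ) (hθ : ∀ s, HasDerivAt θ (k s) s)
    (hk : Continuous k) : ∫ s in (0 : ℝ)..ℓ, k s = 2 * Real.pi := by
  rw [intervalIntegral.integral_eq_sub_of_hasDerivAt (fun s _ => hθ s)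
    (hk.intervalIntegrable _ _)]
  have := h.angle_add 0
  rw [zero_add] at this
  linarith

/-- Minkowski's formula: the curvature weighted integral of the support function is the length. -/
theorem IsOval.integral_curvature_mul_slack (h : IsOval c θ (fun _ => 1) ℓ)
    (hθ : ∀ s, HasDerivAt θ (k s) s) (hk : Continuous k) (p : ℂ) :
    ∫ s in (0 : ℝ)..ℓ, k s * slack c θ p s = ℓ := by
  have hd : ∀ s, HasDerivAt (fun s => (c s - p).re * Real.cos (θ s) + (c s - p).im *
      Real.sin (θ s)) (1 - k s * slack c θ p s) s := by
    intro s
    have h1 := (Complex.reCLM.hasFDerivAt.comp_hasDerivAt s ((h.hasDerivAt s).sub_const p)).mul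
      (hθ s).cos
    have h2 := (Complex.imCLM.hasFDerivAt.comp_hasDerivAt s ((h.hasDerivAt s).sub_const p)).mul
      (hθ s).sin
    refine (h1.add h2).congr_deriv ?_
    simp only [Function.comp_apply, Complex.reCLM_apply, Complex.imCLM_apply, slack_eq,
      Complex.ofReal_one, one_mul, Complex.exp_ofReal_mul_I_re, Complex.exp_ofReal_mul_I_im]
    linear_combination Real.sin_sq_add_cos_sq (θ s)
  have hc : Continuous fun s => k s * slack c θ p s := hk.mul (h.continuous_slack p)
  have h1 := intervalIntegral.integral_eq_sub_of_hasDerivAt (a := 0) (b := ℓ) (fun s _ => hd s)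
    ((continuous_const.sub hc).intervalIntegrable _ _)
  have hθℓ := h.angle_add 0
  have hcℓ := h.periodic 0
  rw [zero_add] at hθℓ hcℓ
  rw [intervalIntegral.integral_sub (continuous_const.intervalIntegrable _ _)
    (hc.intervalIntegrable _ _), hθℓ, hcℓ, Real.cos_add_two_pi, Real.sin_add_two_pi, sub_self] at h1
  simp only [intervalIntegral.integral_const, sub_zero, smul_eq_mul, mul_one] at h1
  linarith

theorem IsOval.toReal_volume_region (h : IsOval c θ q ℓ) {p : ℂ}
    (hp : p ∈ interior (region c θ)) :
    (volume (region c θ)).toReal = 2⁻¹ * ∫ s in (0 : ℝ)..ℓ, q s * slack c θ p s := by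
  rw [h.volume_region hp, ENNReal.toReal_ofReal]
  refine mul_nonneg (by norm_num) (intervalIntegral.integral_nonneg h.length_pos.le fun s _ =>
    mul_nonneg (h.speed_nonneg s) (slack_pos_of_mem_interior subset_rfl hp s).le)

theorem IsOval.volume_ne_top (h : IsOval c θ q ℓ) (hint : (interior (region c θ)).Nonempty) :
    volume (region c θ) ≠ ⊤ := by
  obtain ⟨p, hp⟩ := hint
  rw [h.volume_region hp]
  exact ENNReal.ofReal_ne_top

/-- Steiner's formula for the area of an inner parallel region. -/
theorem IsOval.toReal_volume_region_offset (h : IsOval c θ (fun _ => 1) ℓ)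
    (hθ : ∀ s, HasDerivAt θ (k s) s) (hk : Continuous k) {t : ℝ} (ht0 : 0 ≤ t)
    (ht : ∀ s, t * k s ≤ 1) (hint : (interior (region (offset c θ t) θ)).Nonempty) :
    (volume (region (offset c θ t) θ)).toReal
      = (volume (region c θ)).toReal - t * ℓ + Real.pi * t ^ 2 := by
  obtain ⟨p, hp⟩ := hint
  rw [(h.isOval_offset hθ hk ht).toReal_volume_region hp,
    h.toReal_volume_region (interior_mono (region_offset_subset ht0) hp)]
  have hs := h.continuous_slack p
  have hpt : ∀ s, (1 - t * k s) * slack (offset c θ t) θ p s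
      = 1 * slack c θ p s - t * (k s * slack c θ p s) - (t - t ^ 2 * k s) := by
    intro s
    rw [slack_offset]
    ring
  simp only [hpt, one_mul]
  rw [intervalIntegral.integral_sub, intervalIntegral.integral_sub,
    intervalIntegral.integral_const_mul, h.integral_curvature_mul_slack hθ hk,
    intervalIntegral.integral_sub, intervalIntegral.integral_const_mul,
    h.integral_curvature hθ hk]
  · simp
    ring
  all_goals exact (by fun_prop : Continuous _).intervalIntegrable _ _

theorem IsOval.integral_offset_speed (h : IsOval c θ (fun _ => 1) ℓ)
    (hθ : ∀ s, HasDerivAt θ (k s) s) (hk : Continuous k) (t : ℝ) :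
    ∫ s in (0 : ℝ)..ℓ, (1 - t * k s) = ℓ - 2 * Real.pi * t := by
  rw [intervalIntegral.integral_sub, intervalIntegral.integral_const_mul,
    h.integral_curvature hθ hk]
  · simp
    ring
  all_goals exact (by fun_prop : Continuous _).intervalIntegrable _ _

theorem IsOval.integral_offset_speed_nonneg (h : IsOval c θ (fun _ => 1) ℓ)
    (hθ : ∀ s, HasDerivAt θ (k s) s) (hk : Continuous k) {t : ℝ} (ht : ∀ s, t * k s ≤ 1) :
    0 ≤ ℓ - 2 * Real.pi * t := by
  rw [← h.integral_offset_speed hθ hk]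
  exact intervalIntegral.integral_nonneg h.length_pos.le fun s _ => sub_nonneg.2 (ht s)

/-- Steiner's formula for the perimeter of an inner parallel region. -/
theorem IsOval.toReal_hausdorffMeasure_frontier_offset (h : IsOval c θ (fun _ => 1) ℓ)
    (hθ : ∀ s, HasDerivAt θ (k s) s) (hk : Continuous k) {t : ℝ}
    (ht : ∀ s, t * k s ≤ 1) (hint : (interior (region (offset c θ t) θ)).Nonempty) :
    (Measure.hausdorffMeasure 1 (frontier (region (offset c θ t) θ))).toReal
      = ℓ - 2 * Real.pi * t := by
  rw [(h.isOval_offset hθ hk ht).hausdorffMeasure_frontier hint, h.integral_offset_speed hθ hk,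
    ENNReal.toReal_ofReal (h.integral_offset_speed_nonneg hθ hk ht)]

/-! ### Circles -/

theorem IsOval.region_eq_closedBall (h : IsOval c θ q ℓ) {x₀ : ℂ} {R : ℝ}
    (hc : ∀ s, c s = x₀ - R * (I * Complex.exp (θ s * I))) :
    region c θ = Metric.closedBall x₀ R := by
  have hslack : ∀ x s, slack c θ x s = R - (conj (x - x₀) * Complex.exp (θ s * I)).im := by
    intro x s
    rw [slack_eq, hc]
    simp only [Complex.mul_im, Complex.mul_re, Complex.sub_re, Complex.sub_im,
      Complex.conj_re, Complex.conj_im, Complex.ofReal_re, Complex.ofReal_im,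
      Complex.I_re, Complex.I_im, Complex.exp_ofReal_mul_I_re, Complex.exp_ofReal_mul_I_im]
    linear_combination R * Real.sin_sq_add_cos_sq (θ s)
  ext x
  rw [Metric.mem_closedBall, dist_eq_norm]
  constructor
  · intro hx
    -- the tangent whose outer normal points from `x₀` to `x`
    obtain ⟨s, -, hs⟩ := exists_mem_Ico_exp_eq h.continuous_angle h.length_pos h.angle_add
      (I * (x - x₀))
    have h1 := hx s
    rw [hslack] at h1
    rcases eq_or_ne x x₀ with rfl | hne
    · simpa using h1
    · have hn : 0 < ‖x - x₀‖ := norm_pos_iff.2 (sub_ne_zero.2 hne)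
      rw [norm_mul, Complex.norm_I, one_mul] at hs
      have h2 : (‖x - x₀‖ : ℂ) * (conj (x - x₀) * Complex.exp (θ s * I))
          = ((‖x - x₀‖ ^ 2 : ℝ) : ℂ) * I := by
        rw [mul_left_comm, ← hs, mul_left_comm, mul_comm (conj (x - x₀)), Complex.mul_conj,
          Complex.normSq_eq_norm_sq, mul_comm]
      have h3 := congrArg Complex.im h2
      rw [Complex.im_ofReal_mul, Complex.im_ofReal_mul, Complex.I_im, mul_one, sq] at h3
      rw [mul_left_cancel₀ hn.ne' h3] at h1
      linarith
  · intro hx s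
    rw [hslack]
    have := Complex.abs_im_le_norm (conj (x - x₀) * Complex.exp (θ s * I))
    rw [norm_mul, Complex.norm_exp_ofReal_mul_I, mul_one, RCLike.norm_conj] at this
    linarith [le_abs_self (conj (x - x₀) * Complex.exp (θ s * I)).im]

/-- If an inner parallel region has no interior, then the curve is a circle. The offset curve then
lies on a line, so that at each parameter either it stands still, or its direction is constant
nearby and its speed `1 - t k` equals `1`; by continuity of the curvature one of the two cases
occurs everywhere. (Without continuity of the curvature, a stadium would be a counterexample.) -/
theorem IsOval.interior_region_offset_nonempty (h : IsOval c θ (fun _ => 1) ℓ)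
    (hθ : ∀ s, HasDerivAt θ (k s) s) (hk : Continuous k)
    (hdisk : ¬ ∃ (x₀ : ℂ) (R : ℝ), region c θ = Metric.closedBall x₀ R)
    {t : ℝ} (ht : ∀ s, t * k s ≤ 1) :
    (interior (region (offset c θ t) θ)).Nonempty := by
  by_contra hint
  have ho := h.isOval_offset hθ hk ht
  rw [convex_region.interior_nonempty_iff_affineSpan_eq_top] at hint
  have hne : (affineSpan ℝ (region (offset c θ t) θ) : Set ℂ).Nonempty :=
    (affineSpan_nonempty ℝ).2 ⟨_, ho.mem_region 0⟩
  have hdir : (affineSpan ℝ (region (offset c θ t) θ)).direction < ⊤ :=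
    lt_top_iff_ne_top.2 fun h => hint
      ((AffineSubspace.direction_eq_top_iff_of_nonempty hne).1 h)
  obtain ⟨f, hf, hle⟩ := Submodule.exists_le_ker_of_lt_top _ hdir
  set F : ℂ →L[ℝ] ℝ := LinearMap.toContinuousLinearMap f with hF
  have hconst : ∀ s, F (offset c θ t s) = F (offset c θ t 0) := by
    intro s
    have := hle (AffineSubspace.vsub_mem_direction (mem_affineSpan ℝ (ho.mem_region s))
      (mem_affineSpan ℝ (ho.mem_region 0)))
    rw [LinearMap.mem_ker, vsub_eq_sub, map_sub, sub_eq_zero] at this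
    exact this
  have hprod : ∀ s, (1 - t * k s) * F (Complex.exp (θ s * I)) = 0 := by
    intro s
    have h1 := F.hasFDerivAt.comp_hasDerivAt s (ho.hasDerivAt s)
    have h2 : (F ∘ offset c θ t) = fun _ => F (offset c θ t 0) :=
      funext hconst
    rw [h2] at h1
    have h3 := h1.unique (hasDerivAt_const s _)
    rwa [← Complex.real_smul, map_smul, smul_eq_mul] at h3
  have hzero : ∀ u : ℂ, u ≠ 0 → F u = 0 → F (I * u) = 0 → False := by
    intro u hu h1 h2
    refine hf (LinearMap.ext fun x => ?_)
    have hx : x = (x / u).re • u + (x / u).im • (I * u) := by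
      simp only [Complex.real_smul]
      rw [← mul_assoc, ← add_mul, Complex.re_add_im, div_mul_cancel₀ _ hu]
    change F x = 0
    rw [hx, map_add, map_smul, map_smul, h1, h2]
    simp
  have hdich : ∀ s, 1 - t * k s = 0 ∨ 1 - t * k s = 1 := by
    intro s
    by_cases hs : 1 - t * k s = 0
    · exact Or.inl hs
    · right
      have hev : ∀ᶠ y in nhds s, F (Complex.exp (θ y * I)) = 0 := by
        filter_upwards [ho.continuous_speed.continuousAt.eventually_ne hs] with y hy
        exact (mul_eq_zero.1 (hprod y)).resolve_left hy
      have h1 := F.hasFDerivAt.comp_hasDerivAt s (hasDerivAt_tangent (hθ s))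
      have h2 : HasDerivAt (F ∘ fun s => Complex.exp (θ s * I)) 0 s :=
        (hasDerivAt_const s (0 : ℝ)).congr_of_eventuallyEq hev
      have h3 := h1.unique h2
      rw [← Complex.real_smul, map_smul, smul_eq_mul] at h3
      rcases mul_eq_zero.1 h3 with h4 | h4
      · rw [h4]; ring
      · exact (hzero _ (Complex.exp_ne_zero _) hev.self_of_nhds h4).elim
  by_cases hall : ∀ s, 1 - t * k s = 0
  · refine hdisk ⟨offset c θ t 0, t, h.region_eq_closedBall fun s => ?_⟩
    have hd : ∀ s, HasDerivAt (offset c θ t) 0 s := fun s =>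
      (ho.hasDerivAt s).congr_deriv (by rw [hall s]; simp)
    have := is_const_of_deriv_eq_zero (fun s => (hd s).differentiableAt)
      (fun s => (hd s).deriv) s 0
    rw [← this, offset]
    ring
  · push Not at hall
    obtain ⟨s₁, hs₁⟩ := hall
    have hone : ∀ s, 1 - t * k s = 1 := by
      intro s
      refine (hdich s).resolve_left fun hs => ?_
      obtain ⟨y, hy⟩ := mem_range_of_exists_le_of_exists_ge ho.continuous_speed
        ⟨s, show 1 - t * k s ≤ 1 / 2 by rw [hs]; norm_num⟩
        ⟨s₁, show 1 / 2 ≤ 1 - t * k s₁ by rw [(hdich s₁).resolve_left hs₁]; norm_num⟩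
      simp only at hy
      rcases hdich y with h0 | h0 <;> · rw [h0] at hy; norm_num at hy
    have hdir0 : ∀ u : ℂ, F u = 0 := by
      intro u
      obtain ⟨s, -, hs⟩ := exists_mem_Ico_exp_eq h.continuous_angle h.length_pos h.angle_add u
      have := hprod s
      rw [hone, one_mul] at this
      rw [hs, ← Complex.real_smul, map_smul, this, smul_zero]
    exact hzero 1 one_ne_zero (hdir0 _) (hdir0 _)

/-- The isoperimetric inequality for the region bounded by a convex unit speed curve. -/
theorem IsOval.four_pi_mul_volume_lt (h : IsOval c θ (fun _ => 1) ℓ)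
    (hint : (interior (region c θ)).Nonempty)
    (hdisk : ¬ ∃ (x₀ : ℂ) (R : ℝ), region c θ = Metric.closedBall x₀ R) :
    4 * Real.pi * (volume (region c θ)).toReal < ℓ ^ 2 := by
  obtain ⟨p, hp⟩ := hint
  have hθ := h.continuous_angle
  rw [h.toReal_volume_region hp]
  have := isoperimetric_lt h.length_pos h.hasDerivAt (by fun_prop)
    (by simpa using h.periodic 0) (by simp [Complex.norm_exp_ofReal_mul_I]) ?_ p
  · simp only [slack, Complex.ofReal_one, one_mul] at this ⊢
    linarith
  · rintro ⟨x₀, R, hc⟩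
    refine hdisk ⟨x₀, R, h.region_eq_closedBall fun s => ?_⟩
    -- the equation of the circle extends from one period to the whole line
    obtain ⟨y, hy, hsy⟩ := Function.Periodic.exists_mem_Ico₀
      (f := fun s => c s + R * (I * Complex.exp (θ s * I))) (c := ℓ)
      (fun s => by
        simp only [h.periodic s, h.angle_add]
        push_cast
        rw [add_mul, Complex.exp_add, Complex.exp_two_pi_mul_I, mul_one]) h.length_pos s
    have h1 := hc y ⟨hy.1, hy.2.le⟩
    simp only [Complex.ofReal_one, one_mul] at h1 hsy
    linear_combination hsy + h1

/-! ### Strict concavity of the isoperimetric quotient -/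

/-- With `V (t) = V - t L + π t²` and `A (t) = L - 2 π t` one has
`V (t) / A (t)² = (1 - D / A (t)²) / (4 π)`, where `D = L² - 4 π V` is the isoperimetric deficit. -/
theorem strictConcaveOn_quotient {V L r : ℝ} (hD : 4 * Real.pi * V < L ^ 2)
    (hpos : ∀ t ∈ Icc 0 r, 0 < L - 2 * Real.pi * t) :
    StrictConcaveOn ℝ (Icc 0 r)
      (fun t => (V - t * L + Real.pi * t ^ 2) / (L - 2 * Real.pi * t) ^ 2) := by
  have hpi := Real.pi_pos
  have heq : ∀ t ∈ Icc 0 r, (V - t * L + Real.pi * t ^ 2) / (L - 2 * Real.pi * t) ^ 2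
      = (4 * Real.pi)⁻¹ * (1 - (L ^ 2 - 4 * Real.pi * V) * (L - 2 * Real.pi * t) ^ (-2 : ℤ)) := by
    intro t ht
    have h1 := (hpos t ht).ne'
    have hnum : V - t * L + Real.pi * t ^ 2 = (4 * Real.pi)⁻¹ *
        ((L - 2 * Real.pi * t) ^ 2 - (L ^ 2 - 4 * Real.pi * V)) := by
      field_simp
      ring
    rw [hnum, zpow_neg, zpow_ofNat, mul_div_assoc, sub_div, div_self (pow_ne_zero 2 h1),
      div_eq_mul_inv]
  have hconv : StrictConvexOn ℝ (Ioi 0) fun x : ℝ => x ^ (-2 : ℤ) :=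
    strictConvexOn_zpow (by norm_num) (by norm_num)
  refine ⟨convex_Icc 0 r, fun x hx y hy hxy a b ha hb hab => ?_⟩
  have hz := convex_Icc 0 r hx hy ha.le hb.le hab
  have hlt := hconv.2 (hpos x hx) (hpos y hy) (by
    intro h
    have : 2 * Real.pi * (x - y) = 0 := by linarith
    rcases mul_eq_zero.1 this with h0 | h0
    · linarith
    · exact hxy (sub_eq_zero.1 h0)) ha hb hab
  simp only [smul_eq_mul] at hlt hz ⊢
  have harg : a * (L - 2 * Real.pi * x) + b * (L - 2 * Real.pi * y)
      = L - 2 * Real.pi * (a * x + b * y) := by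
    linear_combination L * hab
  rw [harg] at hlt
  rw [heq x hx, heq y hy, heq _ hz]
  have h2 := mul_lt_mul_of_pos_left hlt (sub_pos.2 hD)
  have h3 : 0 < (4 * Real.pi)⁻¹ := by positivity
  have h4 := mul_lt_mul_of_pos_left h2 h3
  linear_combination h4 + (4 * Real.pi)⁻¹ * hab

theorem IsOval.offset_length_pos (h : IsOval c θ (fun _ => 1) ℓ)
    (hθ : ∀ s, HasDerivAt θ (k s) s) (hk : Continuous k)
    (hint : (interior (region c θ)).Nonempty)
    (hdisk : ¬ ∃ (x₀ : ℂ) (R : ℝ), region c θ = Metric.closedBall x₀ R)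
    {t : ℝ} (ht0 : 0 ≤ t) (ht : ∀ s, t * k s ≤ 1) : 0 < ℓ - 2 * Real.pi * t := by
  refine lt_of_le_of_ne (h.integral_offset_speed_nonneg hθ hk ht) fun h0 => ?_
  have hi := h.interior_region_offset_nonempty hθ hk hdisk ht
  have hV := h.toReal_volume_region_offset hθ hk ht0 ht hi
  have hVpos : 0 < (volume (region (offset c θ t) θ)).toReal :=
    ENNReal.toReal_pos (((isOpen_interior.measure_pos volume hi).trans_le
      (measure_mono interior_subset)).ne') ((h.isOval_offset hθ hk ht).volume_ne_top hi)
  have hD := h.four_pi_mul_volume_lt hint hdisk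
  have hpi := Real.pi_pos
  have h1 : ℓ = 2 * Real.pi * t := by linarith
  rw [hV] at hVpos
  rw [h1] at hVpos hD
  nlinarith

theorem IsOval.strictConcaveOn_isoQuotient (h : IsOval c θ (fun _ => 1) ℓ)
    (hθ : ∀ s, HasDerivAt θ (k s) s) (hk : Continuous k)
    (hint : (interior (region c θ)).Nonempty)
    (hdisk : ¬ ∃ (x₀ : ℂ) (R : ℝ), region c θ = Metric.closedBall x₀ R)
    {r : ℝ} (hr : ∀ t ∈ Icc 0 r, ∀ s, t * k s ≤ 1) :
    StrictConcaveOn ℝ (Icc 0 r) fun t =>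
      (volume (region (offset c θ t) θ)).toReal /
        (Measure.hausdorffMeasure 1
          (frontier (region (offset c θ t) θ))).toReal ^ 2 := by
  refine (strictConcaveOn_quotient (h.four_pi_mul_volume_lt hint hdisk) fun t ht =>
    h.offset_length_pos hθ hk hint hdisk ht.1 (hr t ht)).congr fun t ht => ?_
  have hi := h.interior_region_offset_nonempty hθ hk hdisk (hr t ht)
  simp only
  rw [h.toReal_volume_region_offset hθ hk ht.1 (hr t ht) hi,
    h.toReal_hausdorffMeasure_frontier_offset hθ hk (hr t ht) hi]

/-! ### The boundary curve of a convex body -/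

/-- `c` is a closed simple unit speed curve of period `ℓ` tracing the frontier of `K`, with
velocity `z` and signed curvature `k`; `c` may run in either direction. -/
structure IsUnitSpeedBoundary (K : Set ℂ) (c z : ℝ → ℂ) (k : ℝ → ℝ) (ℓ : ℝ) : Prop where
  length_pos : 0 < ℓ
  hasDerivAt : ∀ s, HasDerivAt c (z s) s
  hasDerivAt_velocity : ∀ s, HasDerivAt z (k s * (I * z s)) s
  norm_velocity : ∀ s, ‖z s‖ = 1
  continuous_curvature : Continuous k
  periodic : Function.Periodic c ℓ
  injOn : InjOn c (Ico 0 ℓ)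
  range_eq : range c = frontier K

variable {K : Set ℂ} {z : ℝ → ℂ}

namespace IsUnitSpeedBoundary

theorem velocity_ne_zero (h : IsUnitSpeedBoundary K c z k ℓ) (s : ℝ) : z s ≠ 0 := by
  rw [← norm_ne_zero_iff, h.norm_velocity]
  exact one_ne_zero

theorem continuous (h : IsUnitSpeedBoundary K c z k ℓ) : Continuous c :=
  continuous_iff_continuousAt.2 fun s => (h.hasDerivAt s).continuousAt

theorem continuous_velocity (h : IsUnitSpeedBoundary K c z k ℓ) : Continuous z :=
  continuous_iff_continuousAt.2 fun s => (h.hasDerivAt_velocity s).continuousAt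

theorem mem_frontier (h : IsUnitSpeedBoundary K c z k ℓ) (s : ℝ) : c s ∈ frontier K :=
  h.range_eq ▸ mem_range_self s

theorem velocity_periodic (h : IsUnitSpeedBoundary K c z k ℓ) : Function.Periodic z ℓ := by
  intro s
  have h1 := (h.hasDerivAt (s + ℓ)).comp_add_const s ℓ
  have h2 : (fun x => c (x + ℓ)) = c := funext h.periodic
  rw [h2] at h1
  exact h1.unique (h.hasDerivAt s)

theorem curvature_periodic (h : IsUnitSpeedBoundary K c z k ℓ) : Function.Periodic k ℓ := by
  intro s
  have h1 := (h.hasDerivAt_velocity (s + ℓ)).comp_add_const s ℓ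
  have h2 : (fun x => z (x + ℓ)) = z := funext h.velocity_periodic
  rw [h2] at h1
  have h3 := h1.unique (h.hasDerivAt_velocity s)
  rw [h.velocity_periodic] at h3
  exact_mod_cast mul_right_cancel₀ (mul_ne_zero Complex.I_ne_zero (h.velocity_ne_zero s)) h3

/-- Running through the boundary in the opposite direction changes the sign of the curvature. -/
theorem reverse (h : IsUnitSpeedBoundary K c z k ℓ) :
    IsUnitSpeedBoundary K (fun s => c (-s)) (fun s => -z (-s)) (fun s => -k (-s)) ℓ where
  length_pos := h.length_pos
  hasDerivAt s := by
    refine ((h.hasDerivAt (-s)).scomp s (hasDerivAt_neg s)).congr_deriv ?_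
    simp
  hasDerivAt_velocity s := by
    refine ((h.hasDerivAt_velocity (-s)).scomp s (hasDerivAt_neg s)).neg.congr_deriv ?_
    simp
  norm_velocity s := by rw [norm_neg, h.norm_velocity]
  continuous_curvature := (h.continuous_curvature.comp continuous_neg).neg
  periodic s := by
    have := h.periodic (-(s + ℓ))
    rw [neg_add, neg_add_cancel_right] at this
    simp only [neg_add]
    exact this.symm
  injOn := by
    -- the parameter in `[0, ℓ)` congruent to `-s`
    have hmem : ∀ s ∈ Ico 0 ℓ, ∃ y ∈ Ico 0 ℓ, c (-s) = c y ∧ (y = -s ∨ y = ℓ - s) ∧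
        (s = 0 ↔ y = 0) := by
      intro s hs
      rcases hs.1.eq_or_lt with h0 | h0
      · subst h0
        exact ⟨0, hs, by simp, Or.inl (by simp), by simp⟩
      · refine ⟨ℓ - s, ⟨by linarith [hs.2], by linarith⟩, ?_, Or.inr rfl, ?_⟩
        · rw [← h.periodic (-s)]
          congr 1
          ring
        · constructor <;> intro h1 <;> linarith [hs.2]
    intro s hs s' hs' hss
    obtain ⟨y, hy, hcy, hy1, hy2⟩ := hmem s hs
    obtain ⟨y', hy', hcy', hy1', hy2'⟩ := hmem s' hs'
    have heq : y = y' := h.injOn hy hy' (by rw [← hcy, ← hcy']; exact hss)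
    subst heq
    by_cases hs0 : s = 0
    · rw [hs0, hy2'.2 (hy2.1 hs0)]
    · have hs0' : s' ≠ 0 := fun h0 => hs0 (hy2.2 (hy2'.1 h0))
      have := hs.1.lt_of_ne' hs0
      have := hs'.1.lt_of_ne' hs0'
      have := hy.1
      rcases hy1 with h1 | h1 <;> rcases hy1' with h1' | h1' <;> linarith
  range_eq := by
    rw [← h.range_eq]
    exact (Equiv.neg ℝ).surjective.range_comp c

/-- The tangent line at a boundary point supports the body, from one side or the other. -/
theorem supporting (h : IsUnitSpeedBoundary K c z k ℓ) (hconv : Convex ℝ K)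
    (hint : (interior K).Nonempty) (s : ℝ) :
    (∀ x ∈ K, 0 ≤ (conj (c s - x) * z s).im) ∨ ∀ x ∈ K, (conj (c s - x) * z s).im ≤ 0 := by
  obtain ⟨f, hf⟩ := geometric_hahn_banach_open_point hconv.interior isOpen_interior
    (h.mem_frontier s).2
  have hle : ∀ x ∈ closure (interior K), f x ≤ f (c s) := fun x hx =>
    closure_minimal (fun y hy => (hf y hy).le) (isClosed_le f.continuous continuous_const) hx
  rw [hconv.closure_interior_eq_closure_of_nonempty_interior hint] at hle
  have htan : f (z s) = 0 := by
    have hd := f.hasFDerivAt.comp_hasDerivAt s (h.hasDerivAt s)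
    refine IsLocalMax.hasDerivAt_eq_zero (Filter.Eventually.of_forall fun y => ?_) hd
    exact hle _ (h.mem_frontier y).1
  have hdecomp : ∀ x, f x - f (c s) = (conj (c s - x) * z s).im * f (I * z s) := by
    intro x
    have hu : (z s).re * (z s).re + (z s).im * (z s).im = 1 := by
      rw [← Complex.normSq_apply, Complex.normSq_eq_norm_sq, h.norm_velocity, one_pow]
    have hx : x - c s = (conj (z s) * (x - c s)).re • z s
        + (conj (c s - x) * z s).im • (I * z s) := by
      apply Complex.ext
      · simp
        linear_combination -(x.re - (c s).re) * hu
      · simp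
        linear_combination -(x.im - (c s).im) * hu
    rw [← map_sub]
    conv_lhs => rw [hx]
    rw [map_add, map_smul, map_smul, htan, smul_zero, zero_add, smul_eq_mul]
  have hnonpos : ∀ x ∈ K, (conj (c s - x) * z s).im * f (I * z s) ≤ 0 := by
    intro x hx
    rw [← hdecomp]
    exact sub_nonpos.2 (hle x (subset_closure hx))
  rcases lt_trichotomy (f (I * z s)) 0 with h0 | h0 | h0
  · left
    intro x hx
    by_contra! hneg
    exact (hnonpos x hx).not_gt (mul_pos_of_neg_of_neg hneg h0)
  · obtain ⟨p, hp⟩ := hint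
    have h1 := hdecomp p
    rw [h0, mul_zero, sub_eq_zero] at h1
    exact ((hf p hp).ne h1).elim
  · right
    intro x hx
    by_contra! hpos
    exact (hnonpos x hx).not_gt (mul_pos hpos h0)

theorem im_ne_zero_of_mem_interior (h : IsUnitSpeedBoundary K c z k ℓ) (hconv : Convex ℝ K)
    {p : ℂ} (hp : p ∈ interior K) (s : ℝ) : (conj (c s - p) * z s).im ≠ 0 := by
  obtain ⟨ε, hε, hball⟩ := Metric.isOpen_iff.1 isOpen_interior p hp
  have hmem : ∀ r : ℝ, |r| < ε → p - r * (I * z s) ∈ K := by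
    intro r hr
    apply interior_subset
    apply hball
    rwa [Metric.mem_ball, dist_eq_norm, sub_sub_cancel_left, norm_neg, norm_mul, norm_mul,
      h.norm_velocity, Complex.norm_I, Complex.norm_real, Real.norm_eq_abs, mul_one, mul_one]
  have hval : ∀ r : ℝ, (conj (c s - (p - r * (I * z s))) * z s).im
      = (conj (c s - p) * z s).im - r := by
    intro r
    have hu : (z s).re * (z s).re + (z s).im * (z s).im = 1 := by
      rw [← Complex.normSq_apply, Complex.normSq_eq_norm_sq, h.norm_velocity, one_pow]
    simp
    linear_combination -r * hu
  have h1 := hmem (ε / 2) (by rw [abs_of_pos (half_pos hε)]; linarith)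
  have h2 := hmem (-(ε / 2)) (by rw [abs_neg, abs_of_pos (half_pos hε)]; linarith)
  intro h0
  rcases h.supporting hconv ⟨p, hp⟩ s with hs | hs
  · have := hs _ h1
    rw [hval, h0] at this
    linarith
  · have := hs _ h2
    rw [hval, h0] at this
    linarith

/-- The body lies on the same side of all the tangent lines of its boundary. -/
theorem orientation (h : IsUnitSpeedBoundary K c z k ℓ) (hconv : Convex ℝ K)
    (hint : (interior K).Nonempty) :
    (∀ s, ∀ x ∈ K, 0 ≤ (conj (c s - x) * z s).im) ∨
      ∀ s, ∀ x ∈ K, (conj (c s - x) * z s).im ≤ 0 := by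
  obtain ⟨p, hp⟩ := hint
  have hc := h.continuous
  have hz := h.continuous_velocity
  have hcont : Continuous fun s => (conj (c s - p) * z s).im := by fun_prop
  have hne := h.im_ne_zero_of_mem_interior hconv hp
  by_cases hpos : ∀ s, 0 < (conj (c s - p) * z s).im
  · left
    intro s
    refine (h.supporting hconv ⟨p, hp⟩ s).resolve_right fun hs => ?_
    exact (hs p (interior_subset hp)).not_gt (hpos s)
  · right
    push Not at hpos
    obtain ⟨s₀, hs₀⟩ := hpos
    intro s
    refine (h.supporting hconv ⟨p, hp⟩ s).resolve_left fun hs => ?_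
    obtain ⟨y, hy⟩ := mem_range_of_exists_le_of_exists_ge hcont ⟨s₀, hs₀⟩
      ⟨s, hs p (interior_subset hp)⟩
    exact hne y hy

/-- The tangent angle of a positively oriented convex boundary turns exactly once per period: it
stays within `π` of the polar angle about an interior point, and the latter turns once because
each ray meets the boundary only once. -/
theorem angle_add (h : IsUnitSpeedBoundary K c z k ℓ) (hconv : Convex ℝ K) {p : ℂ}
    (hp : p ∈ interior K) {θ : ℝ → ℝ} (hθ : ∀ s, HasDerivAt θ (k s) s)
    (hz : ∀ s, z s = Complex.exp (θ s * I)) (hpos : ∀ s, 0 < slack c θ p s) (s : ℝ) :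
    θ (s + ℓ) = θ s + 2 * Real.pi := by
  have hpi := Real.pi_pos
  have hne : ∀ s, c s - p ≠ 0 := fun s => slack_ne_zero_imp_ne (hpos s).ne'
  obtain ⟨φ, hφd, hφ⟩ := exists_polar_angle (w := fun s => c s - p)
    (fun s => (h.hasDerivAt s).sub_const p) h.continuous_velocity hne
  have hφpos : ∀ s, 0 < (z s / (c s - p)).im := by
    intro s
    have := polar_speed_eq (c := c) (θ := θ) (q := fun _ => 1) (p := p) s
    rw [Complex.ofReal_one, one_mul, one_mul, ← hz] at this
    rw [this]
    exact div_pos (hpos s) (by have := norm_pos_iff.2 (hne s); positivity)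
  have hφmono : StrictMono φ := strictMono_of_deriv_pos fun s => by
    rw [(hφd s).deriv]
    exact hφpos s
  have hφc : Continuous φ := continuous_iff_continuousAt.2 fun s => (hφd s).continuousAt
  have hθc : Continuous θ := continuous_iff_continuousAt.2 fun s => (hθ s).continuousAt
  have hsin : ∀ s, 0 < Real.sin (θ s - φ s) := by
    intro s
    have := hpos s
    rw [slack_eq_norm_mul_sin hφ] at this
    exact pos_of_mul_pos_right this (norm_nonneg _)
  -- the polar angle turns once: a second turn would meet the ray through `c 0` again
  obtain ⟨m, hm⟩ : ∃ m : ℤ, φ ℓ = φ 0 + m * (2 * Real.pi) := by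
    apply exists_int_of_exp_eq
    have hcℓ : c ℓ = c 0 := by simpa using h.periodic 0
    have h1 := hφ ℓ
    rw [hcℓ, hφ 0] at h1
    simp only [norm_mul, Complex.norm_real, norm_norm, Complex.norm_exp_ofReal_mul_I,
      mul_one] at h1
    exact (mul_left_cancel₀ (by exact_mod_cast norm_ne_zero_iff.2 (hne 0)) h1).symm
  have hm1 : m = 1 := by
    have h1 := hφmono h.length_pos
    rw [hm] at h1
    have hm0 : (0 : ℝ) < m := by nlinarith
    have hm0' : 0 < m := by exact_mod_cast hm0
    by_contra hne1
    have hm2 : (2 : ℝ) ≤ m := by exact_mod_cast (by omega : 2 ≤ m)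
    obtain ⟨y, hy, hyφ⟩ := intermediate_value_Ioo h.length_pos.le hφc.continuousOn
      (show φ 0 + 2 * Real.pi ∈ Ioo (φ 0) (φ ℓ) by
        constructor
        · linarith
        · rw [hm]; nlinarith)
    have hn0 : 0 < ‖c 0 - p‖ := norm_pos_iff.2 (hne 0)
    have hray : c y - p = ((‖c y - p‖ / ‖c 0 - p‖ : ℝ) : ℂ) * (c 0 - p) := by
      conv_rhs => rw [hφ 0]
      conv_lhs => rw [hφ y, hyφ]
      have : (‖c 0 - p‖ : ℂ) ≠ 0 := by exact_mod_cast hn0.ne'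
      simp only [norm_mul, Complex.norm_real, norm_norm, Complex.norm_exp_ofReal_mul_I, mul_one]
      push_cast
      rw [add_mul, Complex.exp_add, Complex.exp_two_pi_mul_I]
      field_simp
    have := eq_of_mem_frontier_of_ray hconv hp (h.mem_frontier 0) (h.mem_frontier y)
      (div_pos (norm_pos_iff.2 (hne y)) hn0) hray
    exact hy.1.ne (h.injOn ⟨le_rfl, h.length_pos⟩ ⟨hy.1.le, hy.2⟩ this)
  have hθ0 : θ ℓ = θ 0 + 2 * Real.pi := by
    obtain ⟨n, hn⟩ : ∃ n : ℤ, θ ℓ = θ 0 + n * (2 * Real.pi) := by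
      apply exists_int_of_exp_eq
      rw [← hz, ← hz]
      simpa using h.velocity_periodic 0
    have hlt := abs_sub_lt_pi_of_sin_pos (hθc.sub hφc) hsin ℓ 0
    rw [Pi.sub_apply, Pi.sub_apply, hn, hm, hm1, abs_lt] at hlt
    push_cast at hlt
    have h1 : (n : ℝ) < 2 := by nlinarith
    have h2 : (0 : ℝ) < n := by nlinarith
    have h1' : n < 2 := by exact_mod_cast h1
    have h2' : 0 < n := by exact_mod_cast h2
    obtain rfl : n = 1 := by omega
    simpa using hn
  have hd : ∀ s, HasDerivAt (fun s => θ (s + ℓ) - θ s) 0 s := fun s =>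
    (((hθ (s + ℓ)).comp_add_const s ℓ).sub (hθ s)).congr_deriv (by
      rw [h.curvature_periodic, sub_self])
  have := is_const_of_deriv_eq_zero (fun s => (hd s).differentiableAt) (fun s => (hd s).deriv) s 0
  simp only [zero_add] at this
  linarith

/-- The curvature of a positively oriented convex boundary is nonnegative, for otherwise the
boundary would cross its tangent line. -/
theorem curvature_nonneg (h : IsUnitSpeedBoundary K c z k ℓ) (hclosed : IsClosed K) {θ : ℝ → ℝ}
    (hθ : ∀ s, HasDerivAt θ (k s) s) (hz : ∀ s, z s = Complex.exp (θ s * I))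
    (hpos : ∀ s, ∀ x ∈ K, 0 ≤ slack c θ x s) (s₀ : ℝ) : 0 ≤ k s₀ := by
  by_contra! hneg
  set S : ℝ → ℝ := fun s => slack c θ (c s) s₀ with hS
  have hSd : ∀ s, HasDerivAt S (Real.sin (θ s - θ s₀)) s := by
    intro s
    refine (hasDerivAt_slack_comp (h.hasDerivAt s) s₀).congr_deriv ?_
    rw [hz, Complex.exp_ofReal_mul_I_re, Complex.exp_ofReal_mul_I_im, Real.sin_sub]
  have hderiv : deriv S = fun s => Real.sin (θ s - θ s₀) := funext fun s => (hSd s).deriv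
  have hd2 : HasDerivAt (deriv S) (k s₀) s₀ := by
    rw [hderiv]
    have := ((hθ s₀).sub_const (θ s₀)).sin
    simpa using this
  have hmax : IsLocalMax S s₀ := isLocalMax_of_deriv_deriv_neg (by rw [hd2.deriv]; exact hneg)
    (by rw [hderiv]; simp) (hSd s₀).continuousAt
  have hzero : S =ᶠ[nhds s₀] fun _ => 0 := by
    filter_upwards [hmax] with s hs
    have h0 : S s₀ = 0 := slack_self s₀
    rw [h0] at hs
    exact le_antisymm hs (hpos s₀ _ (hclosed.frontier_subset (h.mem_frontier s)))
  have h1 : deriv S =ᶠ[nhds s₀] fun _ => 0 := hzero.deriv.trans (by simp)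
  have h2 := hd2.unique ((hasDerivAt_const s₀ (0 : ℝ)).congr_of_eventuallyEq h1)
  linarith

/-- A convex body with `C²` boundary, positively oriented, is the region of a convex unit speed
curve whose tangent angle has the curvature as derivative. -/
theorem exists_isOval (h : IsUnitSpeedBoundary K c z k ℓ) (hconv : Convex ℝ K)
    (hclosed : IsClosed K) (hint : (interior K).Nonempty)
    (hpos : ∀ s, ∀ x ∈ K, 0 ≤ (conj (c s - x) * z s).im) :
    ∃ θ : ℝ → ℝ, (∀ s, HasDerivAt θ (k s) s) ∧ (∀ s, 0 ≤ k s) ∧ IsOval c θ (fun _ => 1) ℓ ∧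
      region c θ = K := by
  have hzc := h.continuous_velocity
  have hkc := h.continuous_curvature
  obtain ⟨θ, hθd, hz⟩ := exists_polar_angle h.hasDerivAt_velocity (by fun_prop) h.velocity_ne_zero
  have hz : ∀ s, z s = Complex.exp (θ s * I) := by
    intro s
    have := hz s
    rwa [h.norm_velocity, Complex.ofReal_one, one_mul] at this
  have hθ : ∀ s, HasDerivAt θ (k s) s := fun s => (hθd s).congr_deriv (by
    rw [← mul_assoc, mul_div_cancel_right₀ _ (h.velocity_ne_zero s)]
    simp)
  have hpos' : ∀ s, ∀ x ∈ K, 0 ≤ slack c θ x s := by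
    intro s x hx
    rw [slack, ← hz]
    exact hpos s x hx
  have hk0 := h.curvature_nonneg hclosed hθ hz hpos'
  obtain ⟨p, hp⟩ := hint
  have hsub : K ⊆ region c θ := fun x hx s => hpos' s x hx
  have hslack := slack_pos_of_mem_interior hsub hp
  have hoval : IsOval c θ (fun _ => 1) ℓ :=
    { length_pos := h.length_pos
      hasDerivAt := fun s => by
        have := h.hasDerivAt s
        rwa [hz, ← one_mul (Complex.exp _), ← Complex.ofReal_one] at this
      continuous_speed := continuous_const
      speed_nonneg := fun _ => zero_le_one
      continuous_angle := continuous_iff_continuousAt.2 fun s => (hθ s).continuousAt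
      angle_mono := monotone_of_deriv_nonneg (fun s => (hθ s).differentiableAt) fun s => by
        rw [(hθ s).deriv]; exact hk0 s
      angle_add := h.angle_add hconv hp hθ hz hslack
      periodic := h.periodic }
  refine ⟨θ, hθ, hk0, hoval, Subset.antisymm (fun x hx => ?_) hsub⟩
  obtain ⟨s, -, r, hr, hxs⟩ := hoval.exists_ray hslack x
  have hx' : x = (1 - r) • p + r • c s := by
    simp only [Complex.real_smul]
    push_cast
    linear_combination hxs
  have hr1 : r ≤ 1 := by
    have h1 := hx s
    rw [hx', slack_combo _ _ (by ring), slack_self, mul_zero, add_zero] at h1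
    linarith [nonneg_of_mul_nonneg_left h1 (hslack s)]
  rw [hx']
  exact hconv (interior_subset hp) (hclosed.frontier_subset (h.mem_frontier s))
    (sub_nonneg.2 hr1) hr (by ring)

end IsUnitSpeedBoundary

/-! ### Inner parallel bodies in terms of the boundary curve -/

theorem slack_eq_inner {θ : ℝ → ℝ} (x : ℂ) (s : ℝ) :
    slack c θ x s = ⟪c s, -(I * Complex.exp (θ s * I))⟫_ℝ
      - ⟪x, -(I * Complex.exp (θ s * I))⟫_ℝ := by
  rw [slack_eq, ← inner_sub_left, Complex.inner]
  simp only [Complex.mul_re, Complex.mul_im, Complex.neg_re, Complex.neg_im, Complex.conj_re,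
    Complex.conj_im, Complex.I_re, Complex.I_im, Complex.exp_ofReal_mul_I_re,
    Complex.exp_ofReal_mul_I_im]
  ring

/-- The half-planes cut out by the support function, moved inwards by `t`, are the left half-planes
of the tangent lines of the offset curve. -/
theorem IsOval.region_offset_eq {θ q : ℝ → ℝ} (h : IsOval c θ q ℓ) (t : ℝ) :
    region (offset c θ t) θ = {x : ℂ | ∀ u : ℂ, ‖u‖ = 1 →
      ⟪x, u⟫_ℝ ≤ sSup ((fun y : ℂ => ⟪y, u⟫_ℝ) '' region c θ) - t} := by
  have hsup : ∀ s, sSup ((fun y : ℂ => ⟪y, -(I * Complex.exp (θ s * I))⟫_ℝ) '' region c θ)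
      = ⟪c s, -(I * Complex.exp (θ s * I))⟫_ℝ := by
    intro s
    refine IsGreatest.csSup_eq ⟨⟨c s, h.mem_region s, rfl⟩, ?_⟩
    rintro _ ⟨y, hy, rfl⟩
    have := hy s
    rw [slack_eq_inner] at this
    exact sub_nonneg.1 this
  ext x
  rw [mem_region_offset]
  constructor
  · intro hx u hu
    obtain ⟨s, -, hs⟩ := exists_mem_Ico_exp_eq h.continuous_angle h.length_pos h.angle_add (I * u)
    rw [norm_mul, Complex.norm_I, hu, one_mul, Complex.ofReal_one, one_mul] at hs
    have hu' : u = -(I * Complex.exp (θ s * I)) := by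
      rw [← hs, ← mul_assoc, Complex.I_mul_I]
      ring
    have := hx s
    rw [slack_eq_inner, ← hsup, ← hu'] at this
    linarith
  · intro hx s
    have := hx (-(I * Complex.exp (θ s * I))) (by
      rw [norm_neg, norm_mul, Complex.norm_I, Complex.norm_exp_ofReal_mul_I, mul_one])
    rw [hsup] at this
    rw [slack_eq_inner]
    linarith

/-- Strict concavity of the isoperimetric quotient of the inner parallel bodies `P t` of a convex body
in `ℂ`. The positively oriented case suffices, since reversing the boundary preserves `|k|`. -/
theorem IsUnitSpeedBoundary.strictConcaveOn_isoQuotient (h : IsUnitSpeedBoundary K c z k ℓ)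
    (hconv : Convex ℝ K) (hclosed : IsClosed K) (hint : (interior K).Nonempty)
    (hdisk : ¬ ∃ (x₀ : ℂ) (R : ℝ), K = Metric.closedBall x₀ R) {P : ℝ → Set ℂ}
    (hP : ∀ t, P t = {x : ℂ | ∀ u : ℂ, ‖u‖ = 1 →
      ⟪x, u⟫_ℝ ≤ sSup ((fun y : ℂ => ⟪y, u⟫_ℝ) '' K) - t}) :
    0 < (⨆ s, |k s|)⁻¹ ∧ (∀ t ∈ Icc 0 (⨆ s, |k s|)⁻¹, (interior (P t)).Nonempty) ∧
      StrictConcaveOn ℝ (Icc 0 (⨆ s, |k s|)⁻¹) fun t =>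
        (volume (P t)).toReal / (Measure.hausdorffMeasure 1 (frontier (P t))).toReal ^ 2 := by
  wlog hpos : ∀ s, ∀ x ∈ K, 0 ≤ (conj (c s - x) * z s).im generalizing c z k
  · have hneg := (h.orientation hconv hint).resolve_left hpos
    have hrev := this h.reverse fun s x hx => by
      have := hneg (-s) x hx
      rw [mul_neg, Complex.neg_im]
      linarith
    have hsup : (⨆ s, |-k (-s)|) = ⨆ s, |k s| := by
      simp only [abs_neg]
      exact (Equiv.neg ℝ).surjective.iSup_comp fun s => |k s|
    rwa [hsup] at hrev
  obtain ⟨θ, hθ, hk0, hoval, hK⟩ := h.exists_isOval hconv hclosed hint hpos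
  have hk := h.continuous_curvature
  have hbdd : BddAbove (range fun s => |k s|) := by
    obtain ⟨B, hB⟩ := (isCompact_Icc (a := (0 : ℝ)) (b := ℓ)).bddAbove_image
      hk.abs.continuousOn
    refine ⟨B, ?_⟩
    rintro _ ⟨s, rfl⟩
    obtain ⟨y, hy, hsy⟩ := h.curvature_periodic.exists_mem_Ico₀ h.length_pos s
    exact hB ⟨y, ⟨hy.1, hy.2.le⟩, by simp [hsy]⟩
  have hle : ∀ s, k s ≤ ⨆ s, |k s| := fun s => (le_abs_self _).trans (le_ciSup hbdd s)
  -- the tangent angle turns, so the curvature cannot vanish identically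
  have hsup : 0 < ⨆ s, |k s| := by
    by_contra! hnonpos
    have hz : ∀ s, k s = 0 := fun s => le_antisymm ((hle s).trans hnonpos) (hk0 s)
    have := hoval.integral_curvature hθ hk
    simp [hz, Real.pi_ne_zero] at this
  have ht : ∀ t ∈ Icc 0 (⨆ s, |k s|)⁻¹, ∀ s, t * k s ≤ 1 := by
    intro t ht s
    calc t * k s ≤ (⨆ s, |k s|)⁻¹ * ⨆ s, |k s| :=
          mul_le_mul ht.2 (hle s) (hk0 s) (inv_nonneg.2 hsup.le)
      _ = 1 := inv_mul_cancel₀ hsup.ne'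
  have hPr : ∀ t, P t = region (offset c θ t) θ := fun t => by
    rw [hP, hoval.region_offset_eq, hK]
  rw [← hK] at hint hdisk
  refine ⟨inv_pos.2 hsup, fun t htm => ?_, ?_⟩
  · rw [hPr]
    exact hoval.interior_region_offset_nonempty hθ hk hdisk (ht t htm)
  · simp only [hPr]
    exact hoval.strictConcaveOn_isoQuotient hθ hk hint hdisk ht

/-! ### Transport to the Euclidean plane -/

/-- The complex plane as the Euclidean plane. -/
noncomputable def planeEquiv : ℂ ≃ₗᵢ[ℝ] PlaneConvex.Plane := Complex.orthonormalBasisOneI.repr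

theorem isUnitSpeedBoundary_of_isArcLengthBoundary {K : Set PlaneConvex.Plane}
    {γ : ℝ → PlaneConvex.Plane} {ℓ : ℝ} (hγ : PlaneConvex.IsArcLengthBoundary K γ ℓ) :
    ∃ k : ℝ → ℝ, (∀ s, |k s| = PlaneConvex.curvature γ s) ∧
      IsUnitSpeedBoundary (planeEquiv ⁻¹' K) (fun s => planeEquiv.symm (γ s))
        (fun s => planeEquiv.symm (deriv γ s)) k ℓ := by
  have hd1 : ∀ s, HasDerivAt γ (deriv γ s) s := fun s =>
    (hγ.contDiff.differentiable (by norm_num) s).hasDerivAt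
  have hC1 : ContDiff ℝ 1 (deriv γ) := by
    have := hγ.contDiff
    rw [show (2 : WithTop ℕ∞) = 1 + 1 by norm_num, contDiff_succ_iff_deriv] at this
    exact this.2.2
  have hd2 : ∀ s, HasDerivAt (deriv γ) (deriv (deriv γ) s) s := fun s =>
    (hC1.differentiable (by norm_num) s).hasDerivAt
  have hcont : Continuous (deriv (deriv γ)) := hC1.continuous_deriv le_rfl
  set e := planeEquiv.symm
  have hE : ∀ {f : ℝ → PlaneConvex.Plane} {f' : PlaneConvex.Plane} {s : ℝ},
      HasDerivAt f f' s → HasDerivAt (fun s => e (f s)) (e f') s := fun {f f' s} hf =>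
    e.toContinuousLinearEquiv.toContinuousLinearMap.hasFDerivAt.comp_hasDerivAt s hf
  set z : ℝ → ℂ := fun s => e (deriv γ s) with hz
  set w : ℝ → ℂ := fun s => e (deriv (deriv γ) s) with hw
  have hzd : ∀ s, HasDerivAt z (w s) s := fun s => hE (hd2 s)
  have hnorm : ∀ s, ‖z s‖ = 1 := fun s => by rw [hz, LinearIsometryEquiv.norm_map, hγ.unit_speed]
  have hu : ∀ s, (z s).re * (z s).re + (z s).im * (z s).im = 1 := fun s => by
    rw [← Complex.normSq_apply, Complex.normSq_eq_norm_sq, hnorm, one_pow]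
  -- the acceleration is orthogonal to the velocity
  have horth : ∀ s, (z s).re * (w s).re + (z s).im * (w s).im = 0 := by
    intro s
    have h1 := Complex.reCLM.hasFDerivAt.comp_hasDerivAt s (hzd s)
    have h2 := Complex.imCLM.hasFDerivAt.comp_hasDerivAt s (hzd s)
    have h3 := (h1.mul h1).add (h2.mul h2)
    have h4 := h3.unique ((hasDerivAt_const s (1 : ℝ)).congr_of_eventuallyEq
      (Filter.Eventually.of_forall hu))
    simp only [Function.comp_apply, Complex.reCLM_apply, Complex.imCLM_apply] at h4
    linarith
  have hwz : ∀ s, w s = (((conj (z s) * w s).im : ℝ) : ℂ) * (I * z s) := by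
    intro s
    have h1 := hu s
    have h2 := horth s
    apply Complex.ext
    · simp
      linear_combination -(w s).re * h1 + (z s).re * h2
    · simp
      linear_combination -(w s).im * h1 + (z s).im * h2
  refine ⟨fun s => (conj (z s) * w s).im, fun s => ?_, ?_⟩
  · have h1 := congrArg norm (hwz s)
    rw [norm_mul, norm_mul, hnorm, Complex.norm_I, mul_one, mul_one, Complex.norm_real,
      Real.norm_eq_abs] at h1
    rw [← h1, hw, LinearIsometryEquiv.norm_map]
    rfl
  · exact
    { length_pos := hγ.length_pos
      hasDerivAt := fun s => hE (hd1 s)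
      hasDerivAt_velocity := fun s => (hzd s).congr_deriv (hwz s)
      norm_velocity := hnorm
      continuous_curvature := by
        have h1 : Continuous z := e.continuous.comp hC1.continuous
        have h2 : Continuous w := e.continuous.comp hcont
        fun_prop
      periodic := fun s => congrArg e (hγ.periodic s)
      injOn := fun s hs s' hs' hss => hγ.injOn hs hs' (e.injective hss)
      range_eq := by
        rw [range_comp' e γ, hγ.range_eq]
        exact (planeEquiv.toEquiv.image_symm_eq_preimage (frontier K)).trans
          (planeEquiv.toHomeomorph.preimage_frontier K) }

theorem supportFun_eq_sSup_preimage (K : Set PlaneConvex.Plane) (u : ℂ) :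
    PlaneConvex.supportFun K (planeEquiv u)
      = sSup ((fun y : ℂ => ⟪y, u⟫_ℝ) '' (planeEquiv ⁻¹' K)) := by
  rw [PlaneConvex.supportFun]
  congr 1
  ext r
  constructor
  · rintro ⟨x, hx, rfl⟩
    refine ⟨planeEquiv.symm x, by simpa using hx, ?_⟩
    simp only
    rw [← planeEquiv.inner_map_map, planeEquiv.apply_symm_apply]
  · rintro ⟨y, hy, rfl⟩
    exact ⟨planeEquiv y, hy, planeEquiv.inner_map_map y u⟩

theorem preimage_innerParallel (K : Set PlaneConvex.Plane) (t : ℝ) :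
    planeEquiv ⁻¹' PlaneConvex.innerParallel K t = {x : ℂ | ∀ u : ℂ, ‖u‖ = 1 →
      ⟪x, u⟫_ℝ ≤ sSup ((fun y : ℂ => ⟪y, u⟫_ℝ) '' (planeEquiv ⁻¹' K)) - t} := by
  ext x
  simp only [PlaneConvex.innerParallel, mem_preimage, mem_ofPred_eq]
  rw [planeEquiv.surjective.forall]
  refine forall_congr' fun u => ?_
  rw [planeEquiv.norm_map, planeEquiv.inner_map_map, supportFun_eq_sSup_preimage]

theorem isoQuotient_eq_preimage (M : Set PlaneConvex.Plane) :
    PlaneConvex.isoQuotient M = (volume (planeEquiv ⁻¹' M)).toReal /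
      (Measure.hausdorffMeasure 1 (frontier (planeEquiv ⁻¹' M))).toReal ^ 2 := by
  have h1 : volume (planeEquiv ⁻¹' M) = volume M :=
    planeEquiv.measurePreserving.measure_preimage_equiv (f := planeEquiv.toMeasurableEquiv) M
  have h2 : frontier (planeEquiv ⁻¹' M) = planeEquiv ⁻¹' frontier M :=
    (planeEquiv.toHomeomorph.preimage_frontier M).symm
  have h3 : Measure.hausdorffMeasure 1 (planeEquiv ⁻¹' frontier M)
      = Measure.hausdorffMeasure 1 (frontier M) :=
    planeEquiv.toIsometryEquiv.hausdorffMeasure_preimage 1 (frontier M)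
  rw [h1, h2, h3]
  rfl

end ConvexCurve

theorem mainTheorem2 (K : ConvexBody PlaneConvex.Plane)
    (hK : (interior (K : Set PlaneConvex.Plane)).Nonempty)
    (γ : ℝ → PlaneConvex.Plane) (ℓ : ℝ)
    (hγ : PlaneConvex.IsArcLengthBoundary (K : Set PlaneConvex.Plane) γ ℓ)
    (hdisk : ¬ ∃ (c : PlaneConvex.Plane) (R : ℝ),
      (K : Set PlaneConvex.Plane) = Metric.closedBall c R) :
    0 < PlaneConvex.minCurvatureRadius γ ∧
    (∀ t ∈ Set.Icc 0 (PlaneConvex.minCurvatureRadius γ),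
      (interior (PlaneConvex.innerParallel (K : Set PlaneConvex.Plane) t)).Nonempty) ∧
    StrictConcaveOn ℝ (Set.Icc 0 (PlaneConvex.minCurvatureRadius γ))
      (fun t => PlaneConvex.isoQuotient
        (PlaneConvex.innerParallel (K : Set PlaneConvex.Plane) t)) := by
  obtain ⟨k, hk, hb⟩ := ConvexCurve.isUnitSpeedBoundary_of_isArcLengthBoundary hγ
  have hint : ∀ M : Set PlaneConvex.Plane, interior (ConvexCurve.planeEquiv ⁻¹' M)
      = ConvexCurve.planeEquiv ⁻¹' interior M := fun M =>
    (ConvexCurve.planeEquiv.toHomeomorph.preimage_interior M).symm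
  have hmain := hb.strictConcaveOn_isoQuotient
    (K.convex.linear_preimage ConvexCurve.planeEquiv.toLinearEquiv.toLinearMap)
    (K.isClosed.preimage ConvexCurve.planeEquiv.continuous)
    (by rw [hint]; exact hK.preimage ConvexCurve.planeEquiv.surjective)
    (by
      rintro ⟨x₀, R, hx⟩
      refine hdisk ⟨ConvexCurve.planeEquiv x₀, R, ?_⟩
      rw [← ConvexCurve.planeEquiv.image_closedBall, ← hx,
        image_preimage_eq _ ConvexCurve.planeEquiv.surjective])
    (fun t => ConvexCurve.preimage_innerParallel (K : Set PlaneConvex.Plane) t)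
  have hr : (⨆ s, |k s|)⁻¹ = PlaneConvex.minCurvatureRadius γ := by
    simp only [hk]
    rfl
  rw [hr] at hmain
  refine ⟨hmain.1, fun t ht => ?_, ?_⟩
  · have := hmain.2.1 t ht
    rw [hint] at this
    obtain ⟨x, hx⟩ := this
    exact ⟨_, hx⟩
  · simp only [ConvexCurve.isoQuotient_eq_preimage]
    exact hmain.2.2
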